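/- Let $d\ge 1$, let $\Omega\subset\mathbb R^d$ be a bounded convex domain with smooth boundary and $|\Omega|=1$, with unit outgoing normal $n$, and let $\lambda_2$ be the second (first positive) eigenvalue of $-\Delta$ on $\Omega$ with homogeneous Neumann boundary conditions, that is, the infimum of $\int_\Omega|\nabla u|^2\,dx\big/\int_\Omega u^2\,dx$ over all $u\in H^1(\Omega)\setminus\{0\}$ with $\int_\Omega u\,dx=0$. Let $p>0$, $p\ne1$, and $$\theta_\star(p,d)=\frac{(d-1)^2\,p}{d\,(d+2)+p}\,,\qquad \theta\in\big(\theta_\star(p,d),1\big)$$ (for $d\ge3$ the existence of such a $\theta$ means $p<\frac{d+2}{d-2}$). For $\Lambda\in\mathbb R$ put $$\mathcal J_\Lambda[u]=\|\nabla u\|_{L^2(\Omega)}^2-\frac{\Lambda}{p-1}\Big[\|u\|_{L^{p+1}(\Omega)}^2-\|u\|_{L^2(\Omega)}^2\Big].$$ For $\beta\in\mathbb R$ put $\kappa=\beta\,(p-1)+1$ and $$R=R(\beta)=-\frac1\theta\Big(\frac{d-1}{d+2}\Big)^2(\kappa+\beta-1)^2+\kappa\,(\beta-1)+(\kappa+\beta-1)\,\frac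 d{d+2}=-\big(a\,\beta^2-2\,b\,\beta+1\big),$$ $$a=\Big(\frac{d-1}{d+2}\Big)^2\frac{p^2}\theta-p+1\,,\qquad b=1-\frac p{d+2}\,,$$ and, if $a\neq0$, $\beta_\pm=\beta_\pm(\theta,p,d)=\frac{b\pm\sqrt{b^2-a}}a$. 1. If $a\ne0$, then $\beta_-\neq\beta_+$ and these are exactly the roots of $R(\beta)=0$. If $a>0$, then $\beta_-<\beta_+$ and $R(\beta)>0$ if and only if $\beta\in(\beta_-,\beta_+)$. 2. Let $\beta$ be such that $R=R(\beta)>0$ (that is, $\beta\in(\beta_-,\beta_+)$ if $a>0$), let $\Lambda\le(1-\theta)\,\lambda_2$, let $I\subset\mathbb R$ be a nondegenerate interval and let $v$ be a positive classical solution on $I\times\overline\Omega$ of $$\frac{\partial v}{\partial t}=v^{2-2\beta}\Big(\Delta v+\kappa\,\frac{|\nabla v|^2}v\Big)\ \text{in }\Omega\,,\qquad \partial_nv=0\ \text{on }\partial\Omega\,,$$ meaning that $v>0$ on $I\times\overline\Omega$, that $v$ and its spatial derivatives of order at most $2$ are continuous on $I\times\overline\Omega$, and that $v(t,\cdot)\in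 C^3(\overline\Omega)$ for every $t\in I$. Then for every $t\in I$ the function $|\nabla v(t,\cdot)|^4/v(t,\cdot)^2$ is integrable on $\Omega$, the function $t\mapsto\mathcal J_\Lambda[v(t,\cdot)^\beta]$ is differentiable at $t$ (one-sidedly at an end point of $I$), and $$\frac d{dt}\,\mathcal J_\Lambda[v^\beta]\le-\,R\,\beta^2\int_\Omega\frac{|\nabla v|^4}{v^2}\,dx\,.$$ -/

import Mathlib

open Set MeasureTheory
open scoped Gradient Laplacian ContDiff

namespace NeumannFlow

/-- Euclidean space of dimension `d`. -/
abbrev E (d : ℕ) : Type := EuclideanSpace ℝ (Fin d)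

/-! ### Smooth domains and their normals -/

/-- `ρ` is a smooth local defining function of `Ω` near the boundary point `x`:
on the open neighbourhood `U` of `x`, `Ω` is the set `ρ < 0`, and `∇ρ(x) ≠ 0`. -/
structure IsLocalDefiningFunction {d : ℕ} (Ω : Set (E d)) (x : E d) (U : Set (E d))
    (ρ : E d → ℝ) : Prop where
  isOpen : IsOpen U
  mem : x ∈ U
  smooth : ContDiffOn ℝ ∞ ρ U
  gradient_ne_zero : ∇ ρ x ≠ 0
  inter_eq : Ω ∩ U = {y ∈ U | ρ y < 0}

/-- `Ω` has a smooth boundary. -/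
def HasSmoothBoundary {d : ℕ} (Ω : Set (E d)) : Prop :=
  ∀ x ∈ frontier Ω, ∃ U ρ, IsLocalDefiningFunction Ω x U ρ

/-- `n` is the unit outgoing normal vector of `Ω` at `x`: it is the direction of the gradient
of a local defining function. -/
def IsUnitOuterNormal {d : ℕ} (Ω : Set (E d)) (x n : E d) : Prop :=
  ‖n‖ = 1 ∧ ∃ U ρ, IsLocalDefiningFunction Ω x U ρ ∧ ∃ c : ℝ, 0 < c ∧ ∇ ρ x = c • n

/-- The homogeneous Neumann condition `∂ₙ f = 0` on `∂Ω`, for a function `f` that is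
differentiable up to the boundary. -/
def NeumannCondition {d : ℕ} (Ω : Set (E d)) (f : E d → ℝ) : Prop :=
  ∀ x ∈ frontier Ω, ∀ n, IsUnitOuterNormal Ω x n → fderivWithin ℝ f (closure Ω) x n = 0

/-! ### The spectral gap -/

/-- `G` is the weak gradient of `u` in `Ω`. -/
def IsWeakGradient {d : ℕ} (Ω : Set (E d)) (u : E d → ℝ) (G : E d → E d) : Prop :=
  ∀ φ : E d → ℝ, ContDiff ℝ ∞ φ → HasCompactSupport φ → tsupport φ ⊆ Ω →
    ∫ x in Ω, u x • ∇ φ x = - ∫ x in Ω, φ x • G x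

/-- `u` belongs to the Sobolev space `H¹(Ω)`, with weak gradient `G`. -/
structure MemH1 {d : ℕ} (Ω : Set (E d)) (u : E d → ℝ) (G : E d → E d) : Prop where
  memLp : MemLp u 2 (volume.restrict Ω)
  memLp_grad : MemLp G 2 (volume.restrict Ω)
  weakGradient : IsWeakGradient Ω u G

/-- The second eigenvalue of `-Δ` on `Ω` with homogeneous Neumann boundary conditions: the
infimum of the Rayleigh quotient over the nonzero functions of `H¹(Ω)` that are orthogonal to
the constants. -/
noncomputable def lambda2 {d : ℕ} (Ω : Set (E d)) : ℝ :=
  sInf {r : ℝ | ∃ u G, MemH1 Ω u G ∧ ∫ x in Ω, u x = 0 ∧ 0 < ∫ x in Ω, u x ^ 2 ∧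
    r = (∫ x in Ω, ‖G x‖ ^ 2) / ∫ x in Ω, u x ^ 2}

/-! ### The functional -/

/-- The norm of `u` in `L^q(Ω)`, for `0 < q < ∞`. -/
noncomputable def normL {d : ℕ} (Ω : Set (E d)) (q : ℝ) (u : E d → ℝ) : ℝ :=
  (∫ x in Ω, |u x| ^ q) ^ (1 / q)

/-- `J_Λ[u] = ‖∇u‖₂² - Λ/(p-1) (‖u‖_{p+1}² - ‖u‖₂²)`. -/
noncomputable def functionalJ {d : ℕ} (Ω : Set (E d)) (p Λ : ℝ) (u : E d → ℝ) : ℝ :=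
  (∫ x in Ω, ‖∇ u x‖ ^ 2) - Λ / (p - 1) * (normL Ω (p + 1) u ^ 2 - normL Ω 2 u ^ 2)

/-! ### The parameters -/

/-- `θ⋆(p,d)`. -/
noncomputable def thetaStar (p : ℝ) (d : ℕ) : ℝ :=
  ((d : ℝ) - 1) ^ 2 * p / ((d : ℝ) * (d + 2) + p)

/-- `κ = β (p - 1) + 1`. -/
def kappa (p β : ℝ) : ℝ := β * (p - 1) + 1

/-- The constant `R`. -/
noncomputable def constR (θ p : ℝ) (d : ℕ) (β : ℝ) : ℝ :=
  -(1 / θ) * (((d : ℝ) - 1) / (d + 2)) ^ 2 * (kappa p β + β - 1) ^ 2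
    + kappa p β * (β - 1) + (kappa p β + β - 1) * ((d : ℝ) / (d + 2))

/-- The coefficient `a` in `R = -(a β² - 2 b β + 1)`. -/
noncomputable def coefA (θ p : ℝ) (d : ℕ) : ℝ :=
  (((d : ℝ) - 1) / (d + 2)) ^ 2 * (p ^ 2 / θ) - p + 1

/-- The coefficient `b` in `R = -(a β² - 2 b β + 1)`. -/
noncomputable def coefB (p : ℝ) (d : ℕ) : ℝ := 1 - p / (d + 2)

/-- The root `β₋(θ,p,d) = (b - √(b² - a)) / a` of `R = 0`, where `a ≠ 0`. -/
noncomputable def betaMinus (θ p : ℝ) (d : ℕ) : ℝ :=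
  (coefB p d - √(coefB p d ^ 2 - coefA θ p d)) / coefA θ p d

/-- The root `β₊(θ,p,d) = (b + √(b² - a)) / a` of `R = 0`, where `a ≠ 0`. -/
noncomputable def betaPlus (θ p : ℝ) (d : ℕ) : ℝ :=
  (coefB p d + √(coefB p d ^ 2 - coefA θ p d)) / coefA θ p d

/-! ### The flow -/

/-- `v` is a positive classical solution, on the time interval `I`, of
`∂v/∂t = v^(2-2β) (Δv + κ |∇v|²/v)` in `Ω` with `∂ₙ v = 0` on `∂Ω`.
The spatial derivatives of order at most two are continuous on `I × closure Ω`, and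
`v(t,·)` is of class `C³` up to the boundary for each `t`. At an end point of `I` which belongs
to `I`, the time derivative is one-sided. -/
structure IsFlowSolution {d : ℕ} (Ω : Set (E d)) (p β : ℝ) (I : Set ℝ) (v : ℝ → E d → ℝ) :
    Prop where
  pos : ∀ t ∈ I, ∀ x ∈ closure Ω, 0 < v t x
  contDiffOn : ∀ t ∈ I, ContDiffOn ℝ 3 (v t) (closure Ω)
  continuousOn : ∀ k : ℕ, k ≤ 2 → ContinuousOn
    (fun z : ℝ × E d => iteratedFDerivWithin ℝ k (v z.1) (closure Ω) z.2) (I ×ˢ closure Ω)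
  equation : ∀ t ∈ I, ∀ x ∈ Ω, HasDerivWithinAt (fun s => v s x)
    (v t x ^ (2 - 2 * β) * (Δ (v t) x + kappa p β * (‖∇ (v t) x‖ ^ 2 / v t x))) I t
  neumann : ∀ t ∈ I, NeumannCondition Ω (v t)

end NeumannFlow

/-! Put u = v^β, c = κ + β - 1, T = |∇v|², L = Δv. Integration by parts shows that ∫ u^(p+1) is
conserved, that ∫ u² has derivative 2β²(p-1) ∫ T, and that ∫ |∇u|² has derivative -2β² ∫ (L +
(β-1)T/v)(L + κT/v). Hence the derivative of the functional is -2β² times P - Λ ∫ T, where P denotes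
the last integral, and it is enough to prove R ∫ T²/v² ≤ P - Λ ∫ T
(`NeumannCondition.constR_mul_integral_le`).

Three facts give this estimate. (i) The spectral gap λ₂ ∫ T ≤ ∫ L²; a share 1 - θ of ∫ L² absorbs
the term in Λ. (ii) The inequality ∫ |D²v|² ≤ ∫ L², where convexity enters: differentiating the
Neumann condition along the boundary gives D²v(∇v, n) ≤ 0. (iii) The identity ∫ div(T ∇v / v) = 0.
Adding (ii) with weight θd/(d-1) and (iii) with weight c d/(d+2) reduces the claim to a pointwise
inequality. For d ≥ 2 it says that the trace-free part of D²v - γ ∇v⊗∇v has nonnegative square norm,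
for a suitable γ (`pointwise_quadratic_bound`).

The integrations by parts rest on a divergence inequality (`integral_lineDeriv_nonneg`) obtained
from cutoffs that are functions of the gauge of Ω: the gauge is Lipschitz, equals 1 exactly on the
boundary, and its derivative is constant along rays. The algebra of the roots of R is separate: θ >
θ⋆ says exactly that the discriminant is positive. -/

namespace NeumannFlow

open Filter Topology
open scoped NNReal

variable {d : ℕ} {Ω : Set (E d)} {x₀ : E d}

/-! ### The gauge of a convex domain and its derivative on the boundary. -/

/-- The gauge of `Ω` centred at `x₀`. -/
noncomputable def centeredGauge (Ω : Set (E d)) (x₀ x : E d) : ℝ :=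
  gauge ((fun z => x₀ + z) ⁻¹' Ω) (x - x₀)

theorem preimage_add_mem_nhds_zero (ho : IsOpen Ω) (hx₀ : x₀ ∈ Ω) :
    (fun z => x₀ + z) ⁻¹' Ω ∈ 𝓝 (0 : E d) :=
  (ho.preimage (by fun_prop)).mem_nhds (by simpa using hx₀)

theorem convex_preimage_add (hc : Convex ℝ Ω) : Convex ℝ ((fun z => x₀ + z) ⁻¹' Ω) :=
  hc.translate_preimage_right x₀

theorem centeredGauge_lt_one_iff (ho : IsOpen Ω) (hc : Convex ℝ Ω) (hx₀ : x₀ ∈ Ω) {x : E d} :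
    centeredGauge Ω x₀ x < 1 ↔ x ∈ Ω := by
  rw [centeredGauge, gauge_lt_one_iff_mem_interior (convex_preimage_add hc)
    (preimage_add_mem_nhds_zero ho hx₀), (ho.preimage (by fun_prop)).interior_eq]
  simp

theorem centeredGauge_eq_one_iff (ho : IsOpen Ω) (hc : Convex ℝ Ω) (hx₀ : x₀ ∈ Ω) {x : E d} :
    centeredGauge Ω x₀ x = 1 ↔ x ∈ frontier Ω := by
  rw [centeredGauge, gauge_eq_one_iff_mem_frontier (convex_preimage_add hc)
    (preimage_add_mem_nhds_zero ho hx₀)]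
  have := (Homeomorph.addLeft x₀).preimage_frontier Ω
  simp only [Homeomorph.coe_addLeft] at this
  rw [← this]
  simp

theorem exists_lipschitzWith_centeredGauge (ho : IsOpen Ω) (hc : Convex ℝ Ω) (hx₀ : x₀ ∈ Ω) :
    ∃ K : ℝ≥0, LipschitzWith K (centeredGauge Ω x₀) := by
  obtain ⟨K, hK⟩ := (convex_preimage_add hc).lipschitz_gauge (preimage_add_mem_nhds_zero ho hx₀)
  refine ⟨K, LipschitzWith.of_dist_le_mul fun x y => ?_⟩
  have := hK.dist_le_mul (x - x₀) (y - x₀)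
  simpa [centeredGauge] using this

theorem centeredGauge_dilation {r : ℝ} (hr : 0 ≤ r) (x : E d) :
    centeredGauge Ω x₀ (x₀ + r • (x - x₀)) = r * centeredGauge Ω x₀ x := by
  simp [centeredGauge, gauge_smul_of_nonneg hr]

attribute [irreducible] centeredGauge

/-- The gauge is positively homogeneous of degree one about `x₀`, so its derivative is constant
along rays. With `r` equal to the gauge of `x`, the derivative at an interior point becomes a
derivative at its radial projection to the boundary. -/
theorem hasFDerivAt_centeredGauge_dilation {r : ℝ} (hr : 0 < r) {x : E d} {A : E d →L[ℝ] ℝ}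
    (hA : HasFDerivAt (centeredGauge Ω x₀) A x) :
    HasFDerivAt (centeredGauge Ω x₀) A (x₀ + r⁻¹ • (x - x₀)) := by
  have hx : x₀ + r • (x₀ + r⁻¹ • (x - x₀) - x₀) = x := by
    simp [smul_smul, hr.ne']
  have h1 : HasFDerivAt (fun z : E d => x₀ + r • (z - x₀)) (r • ContinuousLinearMap.id ℝ (E d))
      (x₀ + r⁻¹ • (x - x₀)) :=
    (((hasFDerivAt_id _).sub_const x₀).const_smul r).const_add x₀
  have h2 : HasFDerivAt (centeredGauge Ω x₀) A (x₀ + r • (x₀ + r⁻¹ • (x - x₀) - x₀)) := by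
    rwa [hx]
  have h3 := (HasFDerivAt.comp (f := fun z : E d => x₀ + r • (z - x₀)) _ h2 h1).const_smul r⁻¹
  convert! h3 using 1
  · ext z
    simp [centeredGauge_dilation hr.le, hr.ne']
  · ext z
    simp [hr.ne']

theorem IsLocalDefiningFunction.differentiableAt {y : E d} {U : Set (E d)} {ρ : E d → ℝ}
    (hρ : IsLocalDefiningFunction Ω y U ρ) : DifferentiableAt ℝ ρ y :=
  (hρ.smooth.contDiffAt (hρ.isOpen.mem_nhds hρ.mem)).differentiableAt (by simp)

theorem notMem_of_mem_frontier (ho : IsOpen Ω) {y : E d} (hy : y ∈ frontier Ω) : y ∉ Ω := by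
  rw [ho.frontier_eq] at hy
  exact hy.2

/-- A boundary point is a limit of points with `ρ < 0`, while `ρ y < 0` would put `y` in the open
set `Ω`. -/
theorem IsLocalDefiningFunction.eq_zero (ho : IsOpen Ω) {y : E d} (hy : y ∈ frontier Ω)
    {U : Set (E d)} {ρ : E d → ℝ} (hρ : IsLocalDefiningFunction Ω y U ρ) : ρ y = 0 := by
  refine le_antisymm ?_ ?_
  · have hcl : y ∈ closure (Ω ∩ U) :=
      mem_closure_iff_nhds'.2 fun t ht => by
        obtain ⟨z, hz⟩ := mem_closure_iff_nhds.1 (frontier_subset_closure hy) (t ∩ U)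
          (inter_mem ht (hρ.isOpen.mem_nhds hρ.mem))
        exact ⟨⟨z, hz.2, hz.1.2⟩, hz.1.1⟩
    refine (hρ.differentiableAt.continuousAt.continuousWithinAt
      (s := Ω ∩ U)).closure_le (g := fun _ => (0 : ℝ)) hcl continuousWithinAt_const fun z hz => ?_
    rw [hρ.inter_eq] at hz
    exact hz.2.le
  · by_contra! hlt
    have : y ∈ Ω ∩ U := by
      rw [hρ.inter_eq]
      exact ⟨hρ.mem, hlt⟩
    exact notMem_of_mem_frontier ho hy this.1

theorem hasDerivAt_comp_line {f : E d → ℝ} {A : E d →L[ℝ] ℝ} {y : E d} (hf : HasFDerivAt f A y)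
    (u : E d) : HasDerivAt (fun s : ℝ => f (y + s • u)) (A u) 0 := by
  have hline : HasDerivAt (fun s : ℝ => y + s • u) u 0 := by
    simpa using ((hasDerivAt_id (0 : ℝ)).smul_const u).const_add y
  have hf' : HasFDerivAt f A (y + (0 : ℝ) • u) := by simpa using hf
  exact hf'.comp_hasDerivAt (0 : ℝ) hline

/-- The derivative of the gauge at a boundary point is a nonnegative multiple of the derivative of
any local defining function. -/
theorem hasFDerivAt_centeredGauge_nonpos (ho : IsOpen Ω) (hc : Convex ℝ Ω) (hx₀ : x₀ ∈ Ω)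
    {y : E d} (hy : y ∈ frontier Ω) {U : Set (E d)} {ρ : E d → ℝ}
    (hρ : IsLocalDefiningFunction Ω y U ρ) {A : E d →L[ℝ] ℝ}
    (hA : HasFDerivAt (centeredGauge Ω x₀) A y) {w : E d} (hw : fderiv ℝ ρ y w ≤ 0) :
    A w ≤ 0 := by
  have hρy := hρ.eq_zero ho hy
  have hgy : centeredGauge Ω x₀ y = 1 := (centeredGauge_eq_one_iff ho hc hx₀).2 hy
  -- A direction along which `ρ` strictly decreases enters `Ω`, where the gauge is below its
  -- boundary value 1.
  have key : ∀ u : E d, fderiv ℝ ρ y u < 0 → A u ≤ 0 := by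
    intro u hu
    have h1 := (hasDerivAt_comp_line hρ.differentiableAt.hasFDerivAt u).tendsto_slope_zero_right
    have h2 := (hasDerivAt_comp_line hA u).tendsto_slope_zero_right
    have hcont : Continuous (fun s : ℝ => y + s • u) := by fun_prop
    have hU : ∀ᶠ s : ℝ in 𝓝[>] 0, y + s • u ∈ U :=
      (hcont.continuousAt.eventually_mem
        (by simpa using hρ.isOpen.mem_nhds hρ.mem)).filter_mono nhdsWithin_le_nhds
    refine le_of_tendsto h2 ?_
    filter_upwards [hU, h1.eventually_lt_const hu, self_mem_nhdsWithin] with s hsU hs hs0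
    have hs0' : (0 : ℝ) < s := hs0
    simp only [zero_add, zero_smul, add_zero, hρy, sub_zero, smul_eq_mul, hgy] at hs ⊢
    have hneg : ρ (y + s • u) < 0 := by
      by_contra! hge
      exact absurd hs (not_lt.2 (by positivity))
    have hmem : y + s • u ∈ Ω ∩ U := by
      rw [hρ.inter_eq]
      exact ⟨hsU, hneg⟩
    have := (centeredGauge_lt_one_iff ho hc hx₀).2 hmem.1
    exact mul_nonpos_of_nonneg_of_nonpos (by positivity) (by linarith)
  have hnorm : 0 < fderiv ℝ ρ y (∇ ρ y) := by
    have : ∀ u, fderiv ℝ ρ y u = inner ℝ (∇ ρ y) u := fun u => by simp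
    rw [this]
    exact real_inner_self_pos.2 hρ.gradient_ne_zero
  -- The strict inequality is relaxed by tilting `w` slightly along `-∇ ρ y`.
  have hlim : Tendsto (fun s : ℝ => A (w - s • ∇ ρ y)) (𝓝[>] 0) (𝓝 (A w)) := by
    have : Continuous (fun s : ℝ => A (w - s • ∇ ρ y)) := by fun_prop
    simpa using (this.tendsto 0).mono_left nhdsWithin_le_nhds
  refine le_of_tendsto hlim ?_
  filter_upwards [self_mem_nhdsWithin] with s hs
  refine key _ ?_
  rw [map_sub, map_smul, smul_eq_mul]
  have : 0 < s * fderiv ℝ ρ y (∇ ρ y) := mul_pos hs hnorm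
  linarith

/-! ### The divergence inequality through gauge cutoffs. -/

/-- Divergence inequality on a bounded convex domain, for a Lipschitz vector field that points
outwards on the boundary, tested against the derivative of the gauge. -/
theorem integral_lineDeriv_nonneg (ho : IsOpen Ω) (hb : Bornology.IsBounded Ω) (hc : Convex ℝ Ω)
    (hx₀ : x₀ ∈ Ω) {F : E d → E d} {K : ℝ≥0} (hF : LipschitzOnWith K F (closure Ω))
    (hn : ∀ y ∈ frontier Ω, ∀ A : E d →L[ℝ] ℝ, HasFDerivAt (centeredGauge Ω x₀) A y →
      0 ≤ A (F y)) :
    0 ≤ ∫ x in Ω, ∑ i, lineDeriv ℝ (fun z => F z i) x (EuclideanSpace.single i 1) := by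
  obtain ⟨Kg, hKg⟩ := exists_lipschitzWith_centeredGauge ho hc hx₀
  set g := centeredGauge Ω x₀ with hg
  have hgc : Continuous g := hKg.continuous
  have hFi : ∀ i, LipschitzOnWith K (fun z => F z i) (closure Ω) := fun i =>
    LipschitzOnWith.of_dist_le_mul fun x hx y hy => by
      refine le_trans ?_ (hF.dist_le_mul x hx y hy)
      rw [dist_eq_norm, dist_eq_norm, ← PiLp.sub_apply]
      exact PiLp.norm_apply_le _ i
  choose f hfL hfE using fun i => (hFi i).extend_real
  have hfc : ∀ i, Continuous (f i) := fun i => (hfL i).continuous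
  have hK : IsCompact (closure Ω) := hb.isCompact_closure
  obtain ⟨M, hM⟩ := hb.subset_closedBall x₀
  have hM0 : 0 ≤ M := by
    have := hM hx₀
    simpa using this
  have hvol : volume Ω < ⊤ := hb.measure_lt_top
  -- the cutoff functions
  let ε : ℕ → ℝ := fun n => ((n : ℝ) + 2)⁻¹
  have hε : ∀ n, 0 < ε n := fun n => by positivity
  -- The shift by 2 in `ε` keeps the gauge above 1/2 on every shell, so that dividing by it costs at
  -- most a factor 2.
  have hε2 : ∀ n, ε n ≤ 1 / 2 := fun n => by
    rw [one_div]
    exact inv_anti₀ (by norm_num) (by linarith [(Nat.cast_nonneg n : (0 : ℝ) ≤ n)])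
  have hε0 : Tendsto ε atTop (𝓝 0) :=
    tendsto_inv_atTop_zero.comp (tendsto_atTop_add_const_right _ _ tendsto_natCast_atTop_atTop)
  let χ : ℕ → E d → ℝ := fun n x => max 0 (min 1 ((ε n)⁻¹ * (1 - g x)))
  have hχ0 : ∀ n x, 0 ≤ χ n x := fun n x => le_max_left _ _
  have hχ1 : ∀ n x, χ n x ≤ 1 := fun n x => max_le zero_le_one (min_le_left _ _)
  have hχL : ∀ n, ∃ C : ℝ≥0, LipschitzWith C (χ n) := fun n =>
    ⟨_, (((lipschitzWith_smul (ε n)⁻¹).comp ((LipschitzWith.const 1).sub hKg)).const_min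
      1).const_max 0⟩
  choose C hC using hχL
  have hχsupp : ∀ n x, x ∉ Ω → χ n x = 0 := fun n x hx => by
    have : 1 ≤ g x := not_lt.1 fun h => hx ((centeredGauge_lt_one_iff ho hc hx₀).1 h)
    refine max_eq_left ((min_le_right _ _).trans ?_)
    exact mul_nonpos_of_nonneg_of_nonpos (inv_nonneg.2 (hε n).le) (by linarith)
  have hχcs : ∀ n, HasCompactSupport (χ n) := fun n =>
    HasCompactSupport.intro hK fun x hx => hχsupp n x fun h => hx (subset_closure h)
  have hfint : ∀ n i, Integrable
      (fun x => lineDeriv ℝ (f i) x (EuclideanSpace.single i 1) * χ n x) := fun n i =>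
    ((hC n).continuous.integrable_of_hasCompactSupport (hχcs n)).bdd_mul
      (measurable_lineDeriv (hfc i)).aestronglyMeasurable
      (ae_of_all _ fun x => norm_lineDeriv_le_of_lipschitz ℝ (hfL i))
  have hχint : ∀ n i, Integrable
      (fun x => lineDeriv ℝ (χ n) x (-EuclideanSpace.single i 1) * f i x) := fun n i => by
    rw [← integrableOn_iff_integrable_of_support_subset (s := closure Ω)]
    · exact ((hfc i).continuousOn.integrableOn_compact hK).bdd_mul
        (measurable_lineDeriv (hC n).continuous).aestronglyMeasurable
        (ae_of_all _ fun x => norm_lineDeriv_le_of_lipschitz ℝ (hC n))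
    · intro x hx
      by_contra hxc
      refine hx ?_
      have : χ n =ᶠ[𝓝 x] fun _ => 0 := by
        filter_upwards [isClosed_closure.isOpen_compl.mem_nhds hxc] with z hz
        exact hχsupp n z fun h => hz (subset_closure h)
      beta_reduce
      rw [this.lineDeriv_eq]
      simp [lineDeriv]
  have hibp : ∀ n, ∫ x in Ω, (∑ i, lineDeriv ℝ (f i) x (EuclideanSpace.single i 1)) * χ n x =
      ∫ x, ∑ i, lineDeriv ℝ (χ n) x (-EuclideanSpace.single i 1) * f i x := fun n => by
    rw [setIntegral_eq_integral_of_forall_compl_eq_zero fun x hx => by simp [hχsupp n x hx]]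
    simp_rw [Finset.sum_mul]
    rw [integral_finsetSum _ fun i _ => hfint n i, integral_finsetSum _ fun i _ => hχint n i]
    exact Finset.sum_congr rfl fun i _ => (hfL i).integral_lineDeriv_mul_eq (hC n) (hχcs n) _
  -- the pointwise lower bound
  let B : ℝ := 2 * (Kg * K * M)
  have hB : 0 ≤ B := by positivity
  let shell : ℕ → Set (E d) := fun n => {x | 1 - ε n < g x} ∩ Ω
  have hshell : ∀ n, MeasurableSet (shell n) := fun n =>
    ((isOpen_lt continuous_const hgc).inter ho).measurableSet
  have hpt : ∀ n, ∀ᵐ x, (shell n).indicator (fun _ => -B) x ≤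
      ∑ i, lineDeriv ℝ (χ n) x (-EuclideanSpace.single i 1) * f i x := fun n => by
    filter_upwards [hKg.ae_differentiableAt (μ := volume),
      (hC n).ae_differentiableAt (μ := volume)] with x hgx hχx
    let v : E d := WithLp.toLp 2 fun i => f i x
    have hsum : ∑ i, lineDeriv ℝ (χ n) x (-EuclideanSpace.single i 1) * f i x =
        -fderiv ℝ (χ n) x v := by
      have hv : v = ∑ i, f i x • EuclideanSpace.single i (1 : ℝ) := by
        ext j
        simp [v, Pi.single_apply]
      rw [hv, map_sum, ← Finset.sum_neg_distrib]
      refine Finset.sum_congr rfl fun i _ => ?_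
      rw [hχx.lineDeriv_eq_fderiv, map_neg, map_smul, smul_eq_mul]
      ring
    rw [hsum]
    by_cases hx : x ∈ shell n
    · rw [indicator_of_mem hx]
      have hx1 : 1 - ε n < g x := hx.1
      have hx2 : g x < 1 := (centeredGauge_lt_one_iff ho hc hx₀).2 hx.2
      have hr : 0 < g x := by linarith [hε2 n]
      have hχeq : χ n =ᶠ[𝓝 x] fun z => (ε n)⁻¹ * (1 - g z) := by
        filter_upwards [(isOpen_lt continuous_const hgc).mem_nhds hx1,
          (isOpen_lt hgc continuous_const).mem_nhds hx2] with z hz1 hz2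
        have hz1' : 1 - ε n < g z := hz1
        have hz2' : g z < 1 := hz2
        have h0 : 0 ≤ (ε n)⁻¹ * (1 - g z) :=
          mul_nonneg (inv_nonneg.2 (hε n).le) (by linarith)
        have h1 : (ε n)⁻¹ * (1 - g z) ≤ 1 := by
          rw [inv_mul_le_iff₀ (hε n)]
          linarith
        simp only [χ, min_eq_right h1, max_eq_right h0]
      have hfd : fderiv ℝ (χ n) x v = -((ε n)⁻¹ * fderiv ℝ g x v) := by
        have : HasFDerivAt (fun z => (ε n)⁻¹ * (1 - g z)) ((ε n)⁻¹ • (-fderiv ℝ g x)) x :=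
          (hgx.hasFDerivAt.const_sub 1).const_mul _
        rw [hχeq.fderiv_eq, this.fderiv]
        simp
      rw [hfd, neg_neg]
      -- The sign of `A (F y)` is known only on the boundary, so `F x` is compared with `F` at the
      -- radial projection `y`. The error is of order `ε n`, which compensates the factor `(ε n)⁻¹`
      -- from the slope of the cutoff.
      set y : E d := x₀ + (g x)⁻¹ • (x - x₀) with hy
      have hyA : HasFDerivAt g (fderiv ℝ g x) y :=
        hasFDerivAt_centeredGauge_dilation hr hgx.hasFDerivAt
      have hyf : y ∈ frontier Ω := by
        rw [← centeredGauge_eq_one_iff ho hc hx₀, hy, centeredGauge_dilation (inv_nonneg.2 hr.le)]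
        exact inv_mul_cancel₀ hr.ne'
      have hvF : v = F x := by
        ext i
        exact (hfE i (subset_closure hx.2)).symm
      have hyn := hn y hyf _ hyA
      have hxM : ‖x - x₀‖ ≤ M := by
        have := hM hx.2
        rwa [Metric.mem_closedBall, dist_eq_norm] at this
      have hdist : ‖x - y‖ ≤ 2 * ε n * M := by
        have h1 : x - y = (1 - (g x)⁻¹) • (x - x₀) := by
          rw [hy, sub_smul, one_smul]
          abel
        have h2 : |1 - (g x)⁻¹| ≤ 2 * ε n := by
          have : 1 - (g x)⁻¹ = -((1 - g x) / g x) := by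
            field_simp
            ring
          rw [this, abs_neg, abs_of_nonneg (div_nonneg (by linarith) hr.le), div_le_iff₀ hr]
          nlinarith [hε n, hε2 n]
        rw [h1, norm_smul, Real.norm_eq_abs]
        exact mul_le_mul h2 hxM (norm_nonneg _) (by linarith [hε n])
      have hFd : ‖F x - F y‖ ≤ K * (2 * ε n * M) := by
        have := hF.dist_le_mul x (subset_closure hx.2) y (frontier_subset_closure hyf)
        rw [dist_eq_norm, dist_eq_norm] at this
        exact this.trans (mul_le_mul_of_nonneg_left hdist K.2)
      have hAn : ‖fderiv ℝ g x‖ ≤ Kg := norm_fderiv_le_of_lipschitz ℝ hKg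
      have habs : |fderiv ℝ g x (F x - F y)| ≤ Kg * (K * (2 * ε n * M)) :=
        ((fderiv ℝ g x).le_opNorm _).trans (mul_le_mul hAn hFd (norm_nonneg _) Kg.2)
      have hlow : -(Kg * (K * (2 * ε n * M))) ≤ fderiv ℝ g x v := by
        have : fderiv ℝ g x v = fderiv ℝ g x (F x - F y) + fderiv ℝ g x (F y) := by
          rw [hvF, map_sub]
          ring
        rw [this]
        linarith [neg_le_of_abs_le habs]
      calc -B = (ε n)⁻¹ * -(Kg * (K * (2 * ε n * M))) := by
            have := (hε n).ne'
            simp only [B]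
            field_simp
        _ ≤ _ := mul_le_mul_of_nonneg_left hlow (inv_nonneg.2 (hε n).le)
    · rw [indicator_of_notMem hx]
      have hz : fderiv ℝ (χ n) x = 0 := by
        -- Off the shell the cutoff attains its maximum 1 or its minimum 0, so its derivative
        -- vanishes wherever it exists.
        by_cases hxΩ : x ∈ Ω
        · refine IsLocalMax.fderiv_eq_zero (Eventually.of_forall fun z => ?_)
          have hgx' : g x ≤ 1 - ε n := not_lt.1 fun h => hx ⟨h, hxΩ⟩
          have : χ n x = 1 := by
            have h1 : 1 ≤ (ε n)⁻¹ * (1 - g x) := by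
              rw [le_inv_mul_iff₀ (hε n)]
              linarith
            simp only [χ, min_eq_left h1, max_eq_right zero_le_one]
          rw [this]
          exact hχ1 n z
        · refine IsLocalMin.fderiv_eq_zero (Eventually.of_forall fun z => ?_)
          rw [hχsupp n x hxΩ]
          exact hχ0 n z
      simp [hz]
  have hlow : ∀ n, ∫ x in Ω, (shell n).indicator (fun _ => -B) x ≤
      ∫ x in Ω, (∑ i, lineDeriv ℝ (f i) x (EuclideanSpace.single i 1)) * χ n x := fun n => by
    rw [hibp n, setIntegral_eq_integral_of_forall_compl_eq_zero fun x hx =>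
      indicator_of_notMem (fun h => hx h.2) _]
    refine integral_mono_ae ?_ (integrable_finsetSum _ fun i _ => hχint n i) (hpt n)
    exact (integrable_indicator_iff (hshell n)).2
      (integrableOn_const ((measure_mono inter_subset_right).trans_lt hvol).ne)
  have hεx : ∀ x ∈ Ω, ∀ᶠ n in atTop, g x < 1 - ε n := fun x hx => by
    have hx2 : g x < 1 := (centeredGauge_lt_one_iff ho hc hx₀).2 hx
    filter_upwards [hε0.eventually_lt_const (sub_pos.2 hx2)] with n hn
    linarith
  have hfin : IsFiniteMeasure (volume.restrict Ω) := ⟨by simpa using hvol⟩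
  -- Every point of `Ω` eventually leaves the shells, so the bounded error disappears in the limit.
  have hlim1 : Tendsto (fun n => ∫ x in Ω, (shell n).indicator (fun _ => -B) x) atTop (𝓝 0) := by
    have : (0 : ℝ) = ∫ x in Ω, (0 : ℝ) := by simp
    rw [this]
    refine tendsto_integral_of_dominated_convergence (fun _ => B)
      (fun n => (measurable_const.indicator (hshell n)).aestronglyMeasurable)
      (integrable_const _) (fun n => ae_of_all _ fun x => ?_) ?_
    · refine (norm_indicator_le_norm_self _ _).trans ?_
      simp [abs_of_nonneg hB]
    · filter_upwards [ae_restrict_mem ho.measurableSet] with x hx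
      refine tendsto_const_nhds.congr' ?_
      filter_upwards [hεx x hx] with n hn
      exact (indicator_of_notMem (fun h => absurd h.1 (not_lt.2 hn.le)) _).symm
  have hlim2 : Tendsto
      (fun n => ∫ x in Ω, (∑ i, lineDeriv ℝ (f i) x (EuclideanSpace.single i 1)) * χ n x) atTop
      (𝓝 (∫ x in Ω, ∑ i, lineDeriv ℝ (fun z => F z i) x (EuclideanSpace.single i 1))) := by
    have hm : Measurable fun x => ∑ i, lineDeriv ℝ (f i) x (EuclideanSpace.single i 1) :=
      Finset.measurable_sum _ fun i _ => measurable_lineDeriv (hfc i)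
    refine tendsto_integral_of_dominated_convergence
      (fun _ => ∑ i : Fin d, K * ‖(EuclideanSpace.single i 1 : E d)‖)
      (fun n => (hm.mul (hC n).continuous.measurable).aestronglyMeasurable)
      (integrable_const _) (fun n => ae_of_all _ fun x => ?_) ?_
    · rw [norm_mul]
      refine (mul_le_of_le_one_right (norm_nonneg _) ?_).trans ((norm_sum_le _ _).trans
        (Finset.sum_le_sum fun i _ => norm_lineDeriv_le_of_lipschitz ℝ (hfL i)))
      rw [Real.norm_eq_abs, abs_of_nonneg (hχ0 n x)]
      exact hχ1 n x
    · filter_upwards [ae_restrict_mem ho.measurableSet] with x hx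
      refine tendsto_const_nhds.congr' ?_
      filter_upwards [hεx x hx] with n hn
      have h1 : 1 ≤ (ε n)⁻¹ * (1 - g x) := by
        rw [le_inv_mul_iff₀ (hε n)]
        linarith
      have hχx : χ n x = 1 := by simp only [χ, min_eq_left h1, max_eq_right zero_le_one]
      rw [hχx, mul_one]
      refine Finset.sum_congr rfl fun i _ => Filter.EventuallyEq.lineDeriv_eq ?_
      filter_upwards [ho.mem_nhds hx] with z hz
      exact hfE i (subset_closure hz)
  exact le_of_tendsto_of_tendsto' hlim1 hlim2 hlow

/-! ### Coordinate calculus up to the boundary. -/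

/-- A nonempty bounded convex open set with smooth boundary. -/
structure IsSmoothConvexDomain (Ω : Set (E d)) : Prop where
  isOpen : IsOpen Ω
  isBounded : Bornology.IsBounded Ω
  convex : Convex ℝ Ω
  nonempty : Ω.Nonempty
  smooth : HasSmoothBoundary Ω

/-- The partial derivative of `f` in the direction of the `i`-th coordinate, within `S`. -/
noncomputable def partialDeriv (S : Set (E d)) (i : Fin d) (f : E d → ℝ) (x : E d) : ℝ :=
  fderivWithin ℝ f S x (EuclideanSpace.single i 1)

/-- The gradient of `f` within `S`, by coordinates. -/
noncomputable def gradVec (S : Set (E d)) (f : E d → ℝ) (x : E d) : E d :=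
  WithLp.toLp 2 fun i => partialDeriv S i f x

theorem map_eq_sum_coord (A : E d →L[ℝ] ℝ) (w : E d) :
    A w = ∑ i, w i * A (EuclideanSpace.single i 1) := by
  have hw : w = ∑ i, w i • EuclideanSpace.single i (1 : ℝ) := by
    ext j
    simp [Pi.single_apply]
  conv_lhs => rw [hw]
  simp

theorem inner_eq_sum_coord (x y : E d) : inner ℝ x y = ∑ i, x i * y i := by
  simp [PiLp.inner_apply, mul_comm]

theorem fderivWithin_apply_eq_inner (S : Set (E d)) (f : E d → ℝ) (x w : E d) :
    fderivWithin ℝ f S x w = inner ℝ (gradVec S f x) w := by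
  rw [map_eq_sum_coord, inner_eq_sum_coord]
  exact Finset.sum_congr rfl fun i _ => mul_comm _ _

section PartialDeriv

variable {S : Set (E d)} {f g : E d → ℝ} {x : E d} {i j : Fin d}

theorem partialDeriv_mul (hS : UniqueDiffOn ℝ S) (hx : x ∈ S) (hf : DifferentiableOn ℝ f S)
    (hg : DifferentiableOn ℝ g S) :
    partialDeriv S i (fun z => f z * g z) x =
      partialDeriv S i f x * g x + f x * partialDeriv S i g x := by
  rw [partialDeriv, fderivWithin_fun_mul (hS x hx) (hf x hx) (hg x hx)]
  simp [partialDeriv]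
  ring

theorem partialDeriv_sub (hS : UniqueDiffOn ℝ S) (hx : x ∈ S) (hf : DifferentiableOn ℝ f S)
    (hg : DifferentiableOn ℝ g S) :
    partialDeriv S i (fun z => f z - g z) x = partialDeriv S i f x - partialDeriv S i g x := by
  rw [partialDeriv, fderivWithin_fun_sub (hS x hx) (hf x hx) (hg x hx)]
  rfl

theorem partialDeriv_add (hS : UniqueDiffOn ℝ S) (hx : x ∈ S) (hf : DifferentiableOn ℝ f S)
    (hg : DifferentiableOn ℝ g S) :
    partialDeriv S i (fun z => f z + g z) x = partialDeriv S i f x + partialDeriv S i g x := by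
  rw [partialDeriv, fderivWithin_fun_add (hS x hx) (hf x hx) (hg x hx)]
  rfl

theorem partialDeriv_sum {ι : Type*} {u : Finset ι} {h : ι → E d → ℝ} (hS : UniqueDiffOn ℝ S)
    (hx : x ∈ S) (hh : ∀ k ∈ u, DifferentiableOn ℝ (h k) S) :
    partialDeriv S i (fun z => ∑ k ∈ u, h k z) x = ∑ k ∈ u, partialDeriv S i (h k) x := by
  rw [partialDeriv, fderivWithin_fun_sum (hS x hx) fun k hk => hh k hk x hx]
  simp [partialDeriv]

theorem partialDeriv_comp {φ : ℝ → ℝ} {φ' : ℝ} (hS : UniqueDiffOn ℝ S) (hx : x ∈ S)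
    (hf : DifferentiableOn ℝ f S) (hφ : HasDerivAt φ φ' (f x)) :
    partialDeriv S i (fun z => φ (f z)) x = φ' * partialDeriv S i f x := by
  have := (hφ.comp_hasFDerivWithinAt x (hf x hx).hasFDerivWithinAt).fderivWithin (hS x hx)
  rw [partialDeriv]
  change fderivWithin ℝ (φ ∘ f) S x _ = _
  rw [this]
  simp [partialDeriv]

theorem partialDeriv_congr (hx : x ∈ S) (hfg : EqOn f g S) :
    partialDeriv S i f x = partialDeriv S i g x := by
  rw [partialDeriv, fderivWithin_congr hfg (hfg hx), partialDeriv]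

theorem contDiffOn_partialDeriv {n m : ℕ∞ω} (hS : UniqueDiffOn ℝ S) (hf : ContDiffOn ℝ n f S)
    (hmn : m + 1 ≤ n) : ContDiffOn ℝ m (partialDeriv S i f) S :=
  (hf.fderivWithin hS hmn).clm_apply contDiffOn_const

theorem partialDeriv_partialDeriv (hS : UniqueDiffOn ℝ S) (hx : x ∈ S) (hf : ContDiffOn ℝ 2 f S) :
    partialDeriv S i (partialDeriv S j f) x = fderivWithin ℝ (fderivWithin ℝ f S) S x
      (EuclideanSpace.single i 1) (EuclideanSpace.single j 1) := by
  have h1 : DifferentiableOn ℝ (fderivWithin ℝ f S) S :=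
    (hf.fderivWithin (m := 1) hS (by norm_num)).differentiableOn (by simp)
  have h2 := (h1 x hx).hasFDerivWithinAt.clm_apply
    (hasFDerivWithinAt_const (EuclideanSpace.single j (1 : ℝ)) x S)
  rw [partialDeriv]
  change fderivWithin ℝ (fun z => fderivWithin ℝ f S z (EuclideanSpace.single j 1)) S x _ = _
  rw [h2.fderivWithin (hS x hx)]
  simp

theorem partialDeriv_comm (hS : UniqueDiffOn ℝ S) (hx : x ∈ S) (hxi : x ∈ closure (interior S))
    (hf : ContDiffOn ℝ 2 f S) :
    partialDeriv S i (partialDeriv S j f) x = partialDeriv S j (partialDeriv S i f) x := by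
  rw [partialDeriv_partialDeriv hS hx hf, partialDeriv_partialDeriv hS hx hf]
  exact (hf x hx).isSymmSndFDerivWithinAt (by simp) hS hxi hx _ _

end PartialDeriv

/-! ### The divergence theorem for fields that are C¹ up to the boundary. -/

namespace IsSmoothConvexDomain

variable (hΩ : IsSmoothConvexDomain Ω)
include hΩ

theorem uniqueDiffOn : UniqueDiffOn ℝ (closure Ω) :=
  uniqueDiffOn_convex hΩ.convex.closure
    (hΩ.nonempty.mono (hΩ.isOpen.subset_interior_iff.2 subset_closure))

theorem isCompact : IsCompact (closure Ω) := hΩ.isBounded.isCompact_closure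

theorem closure_mem_nhds {x : E d} (hx : x ∈ Ω) : closure Ω ∈ 𝓝 x :=
  mem_of_superset (hΩ.isOpen.mem_nhds hx) subset_closure

theorem mem_closure_interior {x : E d} (hx : x ∈ closure Ω) : x ∈ closure (interior (closure Ω)) :=
  closure_mono (hΩ.isOpen.subset_interior_iff.2 subset_closure) hx

theorem integrableOn {f : E d → ℝ} (hf : ContinuousOn f (closure Ω)) : IntegrableOn f Ω :=
  (hf.integrableOn_compact hΩ.isCompact).mono_set subset_closure

/-- Divergence inequality for a vector field that is `C¹` up to the boundary. -/
theorem integral_divergence_nonneg (hx₀ : x₀ ∈ Ω) {F : Fin d → E d → ℝ}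
    (hF : ∀ i, ContDiffOn ℝ 1 (F i) (closure Ω))
    (hn : ∀ y ∈ frontier Ω, ∀ A : E d →L[ℝ] ℝ, HasFDerivAt (centeredGauge Ω x₀) A y →
      0 ≤ A (WithLp.toLp 2 fun i => F i y)) :
    0 ≤ ∫ x in Ω, ∑ i, partialDeriv (closure Ω) i (F i) x := by
  have hF' : ContDiffOn ℝ 1 (fun x => (WithLp.toLp 2 fun i => F i x : E d)) (closure Ω) := by
    rw [contDiffOn_piLp]
    exact hF
  obtain ⟨K, hK⟩ := hF'.exists_lipschitzOnWith one_ne_zero hΩ.convex.closure hΩ.isCompact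
  refine (integral_lineDeriv_nonneg hΩ.isOpen hΩ.isBounded hΩ.convex hx₀ hK hn).trans_eq ?_
  refine setIntegral_congr_fun hΩ.isOpen.measurableSet fun x hx => ?_
  refine Finset.sum_congr rfl fun i _ => ?_
  have hd : DifferentiableAt ℝ (F i) x :=
    ((hF i).differentiableOn (by simp)).differentiableAt (hΩ.closure_mem_nhds hx)
  rw [partialDeriv, fderivWithin_of_mem_nhds (hΩ.closure_mem_nhds hx)]
  exact hd.lineDeriv_eq_fderiv

/-- Divergence theorem for a tangential vector field that is `C¹` up to the boundary. -/
theorem integral_divergence_eq_zero (hx₀ : x₀ ∈ Ω) {F : Fin d → E d → ℝ}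
    (hF : ∀ i, ContDiffOn ℝ 1 (F i) (closure Ω))
    (hn : ∀ y ∈ frontier Ω, ∀ A : E d →L[ℝ] ℝ, HasFDerivAt (centeredGauge Ω x₀) A y →
      A (WithLp.toLp 2 fun i => F i y) = 0) :
    ∫ x in Ω, ∑ i, partialDeriv (closure Ω) i (F i) x = 0 := by
  refine le_antisymm ?_ (hΩ.integral_divergence_nonneg hx₀ hF fun y hy A hA => (hn y hy A hA).ge)
  have h := hΩ.integral_divergence_nonneg hx₀ (F := fun i x => -F i x) (fun i => (hF i).neg)
    fun y hy A hA => by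
      have : (WithLp.toLp 2 fun i => -F i y : E d) = -WithLp.toLp 2 fun i => F i y := rfl
      rw [this, map_neg, hn y hy A hA, neg_zero]
  have h' : ∫ x in Ω, ∑ i, partialDeriv (closure Ω) i (fun x => -F i x) x =
      -∫ x in Ω, ∑ i, partialDeriv (closure Ω) i (F i) x := by
    rw [← integral_neg]
    refine setIntegral_congr_fun hΩ.isOpen.measurableSet fun x hx => ?_
    rw [← Finset.sum_neg_distrib]
    refine Finset.sum_congr rfl fun i _ => ?_
    rw [partialDeriv, fderivWithin_fun_neg (hΩ.uniqueDiffOn x (subset_closure hx))]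
    rfl
  linarith

end IsSmoothConvexDomain

/-! ### The Neumann condition and integration by parts. -/

theorem NeumannCondition.fderivWithin_gradient {v : E d → ℝ} (hv : NeumannCondition Ω v)
    {y : E d} (hy : y ∈ frontier Ω) {U : Set (E d)} {ρ : E d → ℝ}
    (hρ : IsLocalDefiningFunction Ω y U ρ) : fderivWithin ℝ v (closure Ω) y (∇ ρ y) = 0 := by
  have hpos : 0 < ‖∇ ρ y‖ := norm_pos_iff.2 hρ.gradient_ne_zero
  have hN : ∇ ρ y = ‖∇ ρ y‖ • (‖∇ ρ y‖⁻¹ • ∇ ρ y) := by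
    rw [smul_smul, mul_inv_cancel₀ hpos.ne', one_smul]
  have := hv y hy (‖∇ ρ y‖⁻¹ • ∇ ρ y)
    ⟨by rw [norm_smul, norm_inv, norm_norm, inv_mul_cancel₀ hpos.ne'], U, ρ, hρ, _, hpos, hN⟩
  rw [hN, map_smul, this, smul_zero]

theorem fderiv_apply_eq_inner_gradient (ρ : E d → ℝ) (y u : E d) :
    fderiv ℝ ρ y u = inner ℝ (∇ ρ y) u := by simp

/-- This form of the Neumann condition uses the unnormalised gradient of one fixed `ρ`, and can
therefore be differentiated along curves in the boundary. -/
theorem NeumannCondition.fderiv_gradVec {v : E d → ℝ} (hv : NeumannCondition Ω v)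
    {y : E d} (hy : y ∈ frontier Ω) {U : Set (E d)} {ρ : E d → ℝ}
    (hρ : IsLocalDefiningFunction Ω y U ρ) : fderiv ℝ ρ y (gradVec (closure Ω) v y) = 0 := by
  rw [fderiv_apply_eq_inner_gradient, real_inner_comm, ← fderivWithin_apply_eq_inner]
  exact hv.fderivWithin_gradient hy hρ

/-- The gradient of a function with the Neumann condition is tangential. -/
theorem NeumannCondition.gauge_gradVec (hΩ : IsSmoothConvexDomain Ω) {v : E d → ℝ}
    (hv : NeumannCondition Ω v) (hx₀ : x₀ ∈ Ω) {y : E d} (hy : y ∈ frontier Ω)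
    {A : E d →L[ℝ] ℝ} (hA : HasFDerivAt (centeredGauge Ω x₀) A y) :
    A (gradVec (closure Ω) v y) = 0 := by
  obtain ⟨U, ρ, hρ⟩ := hΩ.smooth y hy
  have h0 := hv.fderiv_gradVec hy hρ
  refine le_antisymm (hasFDerivAt_centeredGauge_nonpos hΩ.isOpen hΩ.convex hx₀ hy hρ hA h0.le) ?_
  have := hasFDerivAt_centeredGauge_nonpos hΩ.isOpen hΩ.convex hx₀ hy hρ hA
    (w := -gradVec (closure Ω) v y) (by rw [map_neg, h0, neg_zero])
  rw [map_neg] at this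
  linarith

/-- Integration by parts with the Neumann condition: `∫ div (f ∇v) = 0`. -/
theorem NeumannCondition.integral_divergence (hΩ : IsSmoothConvexDomain Ω) {v f : E d → ℝ}
    (hv : NeumannCondition Ω v) (hvc : ContDiffOn ℝ 2 v (closure Ω))
    (hf : ContDiffOn ℝ 1 f (closure Ω)) :
    ∫ x in Ω, ((∑ i, partialDeriv (closure Ω) i f x * partialDeriv (closure Ω) i v x) +
      f x * ∑ i, partialDeriv (closure Ω) i (partialDeriv (closure Ω) i v) x) = 0 := by
  obtain ⟨x₀, hx₀⟩ := hΩ.nonempty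
  have hpd : ∀ i, ContDiffOn ℝ 1 (partialDeriv (closure Ω) i v) (closure Ω) := fun i =>
    contDiffOn_partialDeriv hΩ.uniqueDiffOn hvc (by norm_num)
  rw [← hΩ.integral_divergence_eq_zero hx₀ (F := fun i x => f x * partialDeriv (closure Ω) i v x)
    (fun i => hf.mul (hpd i)) fun y hy A hA => by
      have : (WithLp.toLp 2 fun i => f y * partialDeriv (closure Ω) i v y : E d) =
        f y • gradVec (closure Ω) v y := rfl
      rw [this, map_smul, hv.gauge_gradVec hΩ hx₀ hy hA, smul_zero]]
  refine setIntegral_congr_fun hΩ.isOpen.measurableSet fun x hx => ?_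
  rw [Finset.mul_sum, ← Finset.sum_add_distrib]
  refine Finset.sum_congr rfl fun i _ => ?_
  rw [partialDeriv_mul hΩ.uniqueDiffOn (subset_closure hx) (hf.differentiableOn (by simp))
    ((hpd i).differentiableOn (by simp))]

/-! ### Convexity of the boundary and the Hessian inequality. -/

/-- A convex domain lies on one side of its tangent hyperplanes. -/
theorem IsLocalDefiningFunction.fderiv_sub_nonpos (hΩ : IsSmoothConvexDomain Ω) {z : E d}
    (hz : z ∈ frontier Ω) {U : Set (E d)} {ρ : E d → ℝ} (hρ : IsLocalDefiningFunction Ω z U ρ)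
    {x : E d} (hx : x ∈ closure Ω) : fderiv ℝ ρ z (x - z) ≤ 0 := by
  have hcl : IsClosed {x : E d | fderiv ℝ ρ z (x - z) ≤ 0} :=
    isClosed_le (by fun_prop) continuous_const
  refine closure_minimal (fun x hx => ?_) hcl hx
  have h1 := (hasDerivAt_comp_line hρ.differentiableAt.hasFDerivAt (x - z)).tendsto_slope_zero_right
  have hcont : Continuous (fun s : ℝ => z + s • (x - z)) := by fun_prop
  have hU : ∀ᶠ s : ℝ in 𝓝[>] 0, z + s • (x - z) ∈ U :=
    (hcont.continuousAt.eventually_mem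
      (by simpa using hρ.isOpen.mem_nhds hρ.mem)).filter_mono nhdsWithin_le_nhds
  refine le_of_tendsto h1 ?_
  filter_upwards [hU, Ioc_mem_nhdsGT one_pos] with s hsU hs
  have hmem : z + s • (x - z) ∈ Ω := by
    have := hΩ.convex.add_smul_sub_mem_interior' (frontier_subset_closure hz)
      (by rwa [hΩ.isOpen.interior_eq]) hs
    rwa [hΩ.isOpen.interior_eq] at this
  have hneg : z + s • (x - z) ∈ {y ∈ U | ρ y < 0} := hρ.inter_eq ▸ ⟨hmem, hsU⟩
  simp only [zero_add, zero_smul, add_zero, hρ.eq_zero hΩ.isOpen hz, sub_zero, smul_eq_mul]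
  exact mul_nonpos_of_nonneg_of_nonpos (inv_nonneg.2 hs.1.le) hneg.2.le

/-- Curves in the boundary with a given tangent vector. -/
theorem exists_frontier_curve (hΩ : IsSmoothConvexDomain Ω) (hx₀ : x₀ ∈ Ω) {y w : E d}
    (hy : y ∈ frontier Ω) {A : E d →L[ℝ] ℝ} (hA : HasFDerivAt (centeredGauge Ω x₀) A y)
    (hw : A w = 0) :
    ∃ z : ℝ → E d, z 0 = y ∧ HasDerivAt z w 0 ∧ ∀ᶠ s in 𝓝 0, z s ∈ frontier Ω := by
  have hgy : centeredGauge Ω x₀ y = 1 := (centeredGauge_eq_one_iff hΩ.isOpen hΩ.convex hx₀).2 hy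
  have hg := hasDerivAt_comp_line hA w
  rw [hw] at hg
  have hg0 : centeredGauge Ω x₀ (y + (0 : ℝ) • w) = 1 := by simpa using hgy
  have hline : HasDerivAt (fun s : ℝ => y + s • w - x₀) w 0 := by
    simpa using (((hasDerivAt_id (0 : ℝ)).smul_const w).const_add y).sub_const x₀
  -- The tangent line is projected radially to the boundary. The gauge along the line has derivative
  -- `A w = 0` at 0, so the projection does not change the velocity.
  refine ⟨fun s => x₀ + (centeredGauge Ω x₀ (y + s • w))⁻¹ • (y + s • w - x₀), ?_, ?_, ?_⟩
  · simp [hgy]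
  · have := ((hg.inv (by rw [hg0]; exact one_ne_zero)).smul hline).const_add x₀
    simpa [hgy] using this
  · have hpos : ∀ᶠ s in 𝓝 (0 : ℝ), 0 < centeredGauge Ω x₀ (y + s • w) :=
      hg.continuousAt.eventually (lt_mem_nhds (by simp [hgy]))
    filter_upwards [hpos] with s hs
    rw [← centeredGauge_eq_one_iff hΩ.isOpen hΩ.convex hx₀,
      centeredGauge_dilation (inv_nonneg.2 hs.le), inv_mul_cancel₀ hs.ne']

/-- On the boundary of a convex domain, `D²v(∇v, n) ≤ 0` if `v` satisfies the Neumann condition. -/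
theorem NeumannCondition.gauge_hessian_nonpos (hΩ : IsSmoothConvexDomain Ω) {v : E d → ℝ}
    (hv : NeumannCondition Ω v) (hvc : ContDiffOn ℝ 2 v (closure Ω)) (hx₀ : x₀ ∈ Ω) {y : E d}
    (hy : y ∈ frontier Ω) {A : E d →L[ℝ] ℝ} (hA : HasFDerivAt (centeredGauge Ω x₀) A y) :
    A (WithLp.toLp 2 fun i => ∑ j, partialDeriv (closure Ω) j (partialDeriv (closure Ω) i v) y *
      partialDeriv (closure Ω) j v y) ≤ 0 := by
  obtain ⟨U, ρ, hρ⟩ := hΩ.smooth y hy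
  -- This passes from the gauge to `ρ`, whose gradient can be differentiated again.
  refine hasFDerivAt_centeredGauge_nonpos hΩ.isOpen hΩ.convex hx₀ hy hρ hA ?_
  set S := closure Ω with hS
  set w : E d := gradVec S v y with hw
  -- Along a boundary curve with velocity ∇v(y), the derivative of ⟨∇ρ, ∇v⟩ = 0 reads D²v(∇v, ∇ρ) +
  -- D²ρ(∇v, ∇v) = 0. The claim is therefore D²ρ(∇v, ∇v) ≥ 0.
  obtain ⟨z, hz0, hzw, hzf⟩ := exists_frontier_curve hΩ hx₀ hy hA (hv.gauge_gradVec hΩ hx₀ hy hA)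
  let r : Fin d → E d → ℝ := fun i x => fderiv ℝ ρ x (EuclideanSpace.single i 1)
  have hUy : U ∈ 𝓝 y := hρ.isOpen.mem_nhds hρ.mem
  have hfd : ContDiffAt ℝ 1 (fderiv ℝ ρ) y :=
    (hρ.smooth.contDiffAt hUy).fderiv_right (WithTop.coe_le_coe.2 le_top)
  have hr : ∀ i, DifferentiableAt ℝ (r i) y := fun i =>
    (hfd.differentiableAt (by simp)).clm_apply (differentiableAt_const _)
  have hrz : ∀ i, HasDerivAt (fun s => r i (z s)) (fderiv ℝ (r i) y w) 0 := fun i =>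
    (hr i).hasFDerivAt.comp_hasDerivAt_of_eq 0 hzw hz0.symm
  have hpd : ∀ i, HasDerivAt (fun s => partialDeriv S i v (z s))
      (fderivWithin ℝ (partialDeriv S i v) S y w) 0 := fun i => by
    have hd : DifferentiableWithinAt ℝ (partialDeriv S i v) S y :=
      (contDiffOn_partialDeriv (m := 1) hΩ.uniqueDiffOn hvc (by norm_num)).differentiableOn
        (by simp) y (frontier_subset_closure hy)
    exact hd.hasFDerivWithinAt.comp_hasDerivAt_of_eq 0 hzw
      (hzf.mono fun s hs => frontier_subset_closure hs) hz0.symm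
  have hloc : ∀ᶠ s in 𝓝 (0 : ℝ), IsLocalDefiningFunction Ω (z s) U ρ := by
    have hzc : ContinuousAt z 0 := hzw.continuousAt
    have hne : ∀ᶠ x in 𝓝 y, ∇ ρ x ≠ 0 := by
      have hc : ContinuousAt (∇ ρ) y :=
        (InnerProductSpace.toDual ℝ (E d)).symm.continuous.continuousAt.comp hfd.continuousAt
      exact hc.eventually_ne hρ.gradient_ne_zero
    rw [← hz0] at hne hUy
    filter_upwards [hzc.eventually hne, hzc.eventually hUy] with s hs1 hs2
    exact ⟨hρ.isOpen, hs2, hρ.smooth, hs1, hρ.inter_eq⟩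
  -- differentiate the Neumann condition along the curve
  have hzero : ∑ i, (fderivWithin ℝ (partialDeriv S i v) S y w * r i y +
      w i * fderiv ℝ (r i) y w) = 0 := by
    have h1 : HasDerivAt (fun s => ∑ i, partialDeriv S i v (z s) * r i (z s))
        (∑ i, (fderivWithin ℝ (partialDeriv S i v) S y w * r i (z 0) +
          partialDeriv S i v (z 0) * fderiv ℝ (r i) y w)) 0 :=
      HasDerivAt.fun_sum fun i _ => (hpd i).mul (hrz i)
    have h2 : (fun s => ∑ i, partialDeriv S i v (z s) * r i (z s)) =ᶠ[𝓝 0] fun _ => 0 := by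
      filter_upwards [hzf, hloc] with s hs1 hs2
      rw [← hv.fderiv_gradVec hs1 hs2, map_eq_sum_coord]
      rfl
    have h3 := h1.unique ((hasDerivAt_const (0 : ℝ) (0 : ℝ)).congr_of_eventuallyEq h2)
    rw [hz0] at h3
    exact h3
  -- the normals are monotone along the curve
  have hmono : 0 ≤ ∑ i, w i * fderiv ℝ (r i) y w := by
    have hsl1 := fun i => (hrz i).tendsto_slope_zero_right
    have hzi : ∀ i, HasDerivAt (fun s => z s i) (w i) 0 := fun i =>
      (EuclideanSpace.proj (𝕜 := ℝ) i).hasFDerivAt.comp_hasDerivAt (0 : ℝ) hzw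
    have hsl2 := fun i => (hzi i).tendsto_slope_zero_right
    -- D²ρ(w, w) is the limit of s⁻² ⟨z s - y, ∇ρ(z s) - ∇ρ(y)⟩. This is nonnegative because each of
    -- the two boundary points lies on the inner side of the tangent hyperplane at the other.
    refine ge_of_tendsto (tendsto_finsetSum Finset.univ fun i _ => (hsl2 i).mul (hsl1 i)) ?_
    filter_upwards [hzf.filter_mono nhdsWithin_le_nhds, hloc.filter_mono nhdsWithin_le_nhds]
      with s hs1 hs2
    simp only [zero_add, hz0, smul_eq_mul]
    have e1 := hs2.fderiv_sub_nonpos hΩ hs1 (frontier_subset_closure hy)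
    have e2 := hρ.fderiv_sub_nonpos hΩ hy (frontier_subset_closure hs1)
    rw [map_eq_sum_coord] at e1 e2
    have e3 : ∑ i, s⁻¹ * (z s i - y i) * (s⁻¹ * (r i (z s) - r i y)) =
        s⁻¹ ^ 2 * -(∑ i, (y - z s) i * r i (z s) + ∑ i, (z s - y) i * r i y) := by
      rw [← Finset.sum_add_distrib, ← Finset.sum_neg_distrib, Finset.mul_sum]
      refine Finset.sum_congr rfl fun i _ => ?_
      simp only [PiLp.sub_apply]
      ring
    rw [e3]
    exact mul_nonneg (sq_nonneg _) (by linarith)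
  rw [map_eq_sum_coord]
  have hfin : ∀ i, ∑ j, partialDeriv S j (partialDeriv S i v) y * partialDeriv S j v y =
      fderivWithin ℝ (partialDeriv S i v) S y w := fun i => by
    rw [map_eq_sum_coord]
    exact Finset.sum_congr rfl fun j _ => mul_comm _ _
  simp only [hfin]
  rw [Finset.sum_add_distrib] at hzero
  linarith

/-- On a convex domain, `∫ |D²v|² ≤ ∫ (Δv)²` if `v` satisfies the Neumann condition. -/
theorem NeumannCondition.integral_hessian_sq_le (hΩ : IsSmoothConvexDomain Ω) {v : E d → ℝ}
    (hv : NeumannCondition Ω v) (hvc : ContDiffOn ℝ 3 v (closure Ω)) :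
    0 ≤ ∫ x in Ω, ((∑ i, partialDeriv (closure Ω) i (partialDeriv (closure Ω) i v) x) ^ 2 -
      ∑ i, ∑ j, partialDeriv (closure Ω) j (partialDeriv (closure Ω) i v) x ^ 2) := by
  obtain ⟨x₀, hx₀⟩ := hΩ.nonempty
  set S := closure Ω with hS
  have hu : UniqueDiffOn ℝ S := hΩ.uniqueDiffOn
  have hg : ∀ i, ContDiffOn ℝ 2 (partialDeriv S i v) S := fun i =>
    contDiffOn_partialDeriv hu hvc (by norm_num)
  have hh : ∀ i j, ContDiffOn ℝ 1 (partialDeriv S j (partialDeriv S i v)) S := fun i j =>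
    contDiffOn_partialDeriv hu (hg i) (by norm_num)
  have hg1 : ∀ i, ContDiffOn ℝ 1 (partialDeriv S i v) S := fun i => (hg i).of_le (by norm_num)
  have hgd : ∀ i, DifferentiableOn ℝ (partialDeriv S i v) S := fun i =>
    (hg i).differentiableOn (by simp)
  have hhd : ∀ i j, DifferentiableOn ℝ (partialDeriv S j (partialDeriv S i v)) S := fun i j =>
    (hh i j).differentiableOn (by simp)
  -- The field Δv ∇v - D²v ∇v has divergence (Δv)² - |D²v|². Its first term is tangential on the
  -- boundary and its second one points outwards by `gauge_hessian_nonpos`.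
  have key := hΩ.integral_divergence_nonneg hx₀ (F := fun i x =>
    (∑ k, partialDeriv S k (partialDeriv S k v) x) * partialDeriv S i v x -
      ∑ j, partialDeriv S j (partialDeriv S i v) x * partialDeriv S j v x)
    (fun i => ((ContDiffOn.sum fun k _ => hh k k).mul (hg1 i)).sub
      (ContDiffOn.sum fun j _ => (hh i j).mul (hg1 j)))
    fun y hy A hA => by
      have e : (WithLp.toLp 2 fun i =>
          (∑ k, partialDeriv S k (partialDeriv S k v) y) * partialDeriv S i v y -
          ∑ j, partialDeriv S j (partialDeriv S i v) y * partialDeriv S j v y : E d) =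
          (∑ k, partialDeriv S k (partialDeriv S k v) y) • gradVec S v y -
          WithLp.toLp 2 fun i =>
            ∑ j, partialDeriv S j (partialDeriv S i v) y * partialDeriv S j v y := rfl
      rw [e, map_sub, map_smul, hv.gauge_gradVec hΩ hx₀ hy hA, smul_zero, zero_sub, neg_nonneg]
      exact hv.gauge_hessian_nonpos hΩ (hvc.of_le (by norm_num)) hx₀ hy hA
  refine key.trans_eq (setIntegral_congr_fun hΩ.isOpen.measurableSet fun x hx => ?_)
  have hxS : x ∈ S := subset_closure hx
  have hxi := hΩ.mem_closure_interior hxS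
  have e1 : ∀ i, partialDeriv S i (fun x =>
      (∑ k, partialDeriv S k (partialDeriv S k v) x) * partialDeriv S i v x -
      ∑ j, partialDeriv S j (partialDeriv S i v) x * partialDeriv S j v x) x =
      (∑ k, partialDeriv S i (partialDeriv S k (partialDeriv S k v)) x) * partialDeriv S i v x +
      (∑ k, partialDeriv S k (partialDeriv S k v) x) * partialDeriv S i (partialDeriv S i v) x -
      ∑ j, (partialDeriv S i (partialDeriv S j (partialDeriv S i v)) x * partialDeriv S j v x +
        partialDeriv S j (partialDeriv S i v) x * partialDeriv S i (partialDeriv S j v) x) :=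
    fun i => by
    rw [partialDeriv_sub hu hxS
      ((DifferentiableOn.fun_sum fun k _ => hhd k k).fun_mul (hgd i))
      (DifferentiableOn.fun_sum fun j _ => (hhd i j).fun_mul (hgd j)),
      partialDeriv_mul hu hxS (DifferentiableOn.fun_sum fun k _ => hhd k k) (hgd i),
      partialDeriv_sum hu hxS fun k _ => hhd k k,
      partialDeriv_sum hu hxS fun j _ => (hhd i j).fun_mul (hgd j)]
    congr 1
    exact Finset.sum_congr rfl fun j _ => partialDeriv_mul hu hxS (hhd i j) (hgd j)
  simp only [← hS, e1, Finset.sum_add_distrib, Finset.sum_sub_distrib]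
  -- The third-order terms cancel by symmetry of the mixed derivatives of ∂ᵢv.
  have e2 : ∑ i, (∑ k, partialDeriv S i (partialDeriv S k (partialDeriv S k v)) x) *
      partialDeriv S i v x = ∑ i, ∑ j,
      partialDeriv S i (partialDeriv S j (partialDeriv S i v)) x * partialDeriv S j v x := by
    simp only [Finset.sum_mul]
    rw [Finset.sum_comm]
    refine Finset.sum_congr rfl fun i _ => Finset.sum_congr rfl fun j _ => ?_
    rw [partialDeriv_comm hu hxS hxi (hg i)]
  have e3 : ∑ i, ∑ j, partialDeriv S j (partialDeriv S i v) x *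
      partialDeriv S i (partialDeriv S j v) x =
      ∑ i, ∑ j, partialDeriv S j (partialDeriv S i v) x ^ 2 :=
    Finset.sum_congr rfl fun i _ => Finset.sum_congr rfl fun j _ => by
      rw [partialDeriv_comm hu hxS hxi (hvc.of_le (by norm_num)), sq]
  rw [e2, e3, ← Finset.mul_sum]
  ring

/-! ### Gradient and Laplacian in coordinates. -/

/-- The Laplacian of `f` within `S`, by coordinates. -/
noncomputable def lap (S : Set (E d)) (f : E d → ℝ) (x : E d) : ℝ :=
  ∑ i, partialDeriv S i (partialDeriv S i f) x

/-- The square of the norm of the gradient of `f` within `S`, by coordinates. -/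
noncomputable def gradSq (S : Set (E d)) (f : E d → ℝ) (x : E d) : ℝ :=
  ∑ i, partialDeriv S i f x ^ 2

theorem gradSq_nonneg (S : Set (E d)) (f : E d → ℝ) (x : E d) : 0 ≤ gradSq S f x :=
  Finset.sum_nonneg fun _ _ => sq_nonneg _

theorem norm_gradVec_sq (S : Set (E d)) (f : E d → ℝ) (x : E d) :
    ‖gradVec S f x‖ ^ 2 = gradSq S f x := by
  rw [EuclideanSpace.real_norm_sq_eq]
  rfl

theorem contDiffOn_gradSq {S : Set (E d)} {f : E d → ℝ} {n m : ℕ∞ω} (hS : UniqueDiffOn ℝ S)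
    (hf : ContDiffOn ℝ n f S) (hmn : m + 1 ≤ n) : ContDiffOn ℝ m (gradSq S f) S :=
  ContDiffOn.sum fun _ _ => (contDiffOn_partialDeriv hS hf hmn).pow 2

theorem contDiffOn_lap {S : Set (E d)} {f : E d → ℝ} {n m : ℕ∞ω} (hS : UniqueDiffOn ℝ S)
    (hf : ContDiffOn ℝ n f S) (hmn : m + 1 + 1 ≤ n) : ContDiffOn ℝ m (lap S f) S :=
  ContDiffOn.sum fun _ _ =>
    contDiffOn_partialDeriv hS (contDiffOn_partialDeriv hS hf hmn) le_rfl

theorem gradient_eq_gradVec {S : Set (E d)} {x : E d} (hx : S ∈ 𝓝 x) (f : E d → ℝ) :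
    ∇ f x = gradVec S f x := by
  refine ext_inner_right ℝ fun w => ?_
  rw [← fderivWithin_apply_eq_inner, fderivWithin_of_mem_nhds hx, fderiv_apply_eq_inner_gradient]

theorem norm_gradient_sq {S : Set (E d)} {x : E d} (hx : S ∈ 𝓝 x) (f : E d → ℝ) :
    ‖∇ f x‖ ^ 2 = gradSq S f x := by
  rw [gradient_eq_gradVec hx, norm_gradVec_sq]

theorem laplacian_eq_lap {S : Set (E d)} (hS : UniqueDiffOn ℝ S) {x : E d} (hx : S ∈ 𝓝 x)
    {f : E d → ℝ} (hf : ContDiffOn ℝ 2 f S) : Δ f x = lap S f x := by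
  rw [InnerProductSpace.laplacian_eq_iteratedFDeriv_orthonormalBasis f
    (EuclideanSpace.basisFun (Fin d) ℝ)]
  refine Finset.sum_congr rfl fun i _ => ?_
  rw [partialDeriv_partialDeriv hS (mem_of_mem_nhds hx) hf, iteratedFDeriv_two_apply,
    fderivWithin_of_mem_nhds hx]
  have : fderivWithin ℝ f S =ᶠ[𝓝 x] fderiv ℝ f := by
    filter_upwards [eventually_mem_nhds_iff.2 hx] with z hz
    exact fderivWithin_of_mem_nhds hz
  rw [this.fderiv_eq]
  simp

/-! ### Membership in H¹ and the spectral gap. -/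

theorem IsSmoothConvexDomain.memLp_two {F : Type*} [NormedAddCommGroup F]
    (hΩ : IsSmoothConvexDomain Ω) {f : E d → F} (hf : ContinuousOn f (closure Ω)) :
    MemLp f 2 (volume.restrict Ω) := by
  have hfin : IsFiniteMeasure (volume.restrict Ω) :=
    ⟨by simpa using hΩ.isBounded.measure_lt_top⟩
  obtain ⟨C, hC⟩ := hΩ.isCompact.exists_bound_of_continuousOn hf
  refine MemLp.of_bound
    (ContinuousOn.aestronglyMeasurable_of_isSeparable (hf.mono subset_closure)
      hΩ.isOpen.measurableSet (.of_separableSpace Ω)) C ?_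
  filter_upwards [ae_restrict_mem hΩ.isOpen.measurableSet] with x hx
  exact hC x (subset_closure hx)

theorem continuousOn_gradVec {S : Set (E d)} (hS : UniqueDiffOn ℝ S) {f : E d → ℝ}
    (hf : ContDiffOn ℝ 1 f S) : ContinuousOn (gradVec S f) S := by
  have : ContDiffOn ℝ 0 (gradVec S f) S := by
    rw [contDiffOn_piLp]
    exact fun i => contDiffOn_partialDeriv hS hf (by norm_num)
  exact this.continuousOn

/-- A function that is `C¹` up to the boundary belongs to `H¹`. -/
theorem IsSmoothConvexDomain.memH1 (hΩ : IsSmoothConvexDomain Ω) {u : E d → ℝ}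
    (hu : ContDiffOn ℝ 1 u (closure Ω)) : MemH1 Ω u (gradVec (closure Ω) u) := by
  have hS := hΩ.uniqueDiffOn
  have hGc := continuousOn_gradVec hS hu
  refine ⟨hΩ.memLp_two hu.continuousOn, hΩ.memLp_two hGc, fun φ hφ hφc hφs => ?_⟩
  obtain ⟨x₀, hx₀⟩ := hΩ.nonempty
  set S := closure Ω with hSdef
  have hφ1 : ContDiffOn ℝ 1 φ S := (hφ.of_le (by exact_mod_cast le_top)).contDiffOn
  have hφG := continuousOn_gradVec hS hφ1
  have e0 : ∫ x in Ω, u x • ∇ φ x = ∫ x in Ω, u x • gradVec S φ x :=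
    setIntegral_congr_fun hΩ.isOpen.measurableSet fun x hx => by
      rw [gradient_eq_gradVec (hΩ.closure_mem_nhds hx)]
  have i1 : IntegrableOn (fun x => u x • gradVec S φ x) Ω :=
    ((hu.continuousOn.smul hφG).integrableOn_compact hΩ.isCompact).mono_set subset_closure
  have i2 : IntegrableOn (fun x => φ x • gradVec S u x) Ω :=
    ((hφ1.continuousOn.smul hGc).integrableOn_compact hΩ.isCompact).mono_set subset_closure
  rw [e0, eq_neg_iff_add_eq_zero, ← integral_add i1 i2]
  ext i
  have hproj := (EuclideanSpace.proj (𝕜 := ℝ) i : E d →L[ℝ] ℝ).integral_comp_comm (i1.add i2)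
  change EuclideanSpace.proj (𝕜 := ℝ) i _ = _
  refine hproj.symm.trans ?_
  -- The i-th component of the weak gradient identity is the divergence theorem for uφ eᵢ, which
  -- vanishes on the boundary.
  have hdiv := hΩ.integral_divergence_eq_zero hx₀
    (F := fun k x => if k = i then u x * φ x else 0)
    (fun k => by
      by_cases hk : k = i
      · simpa [hk] using hu.mul hφ1
      · simpa [hk] using contDiffOn_const)
    fun y hy A hA => by
      have hφy : φ y = 0 := by
        by_contra hne
        exact notMem_of_mem_frontier hΩ.isOpen hy (hφs (subset_tsupport φ hne))
      have : (WithLp.toLp 2 fun k => if k = i then u y * φ y else 0 : E d) = 0 := by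
        ext k
        simp [hφy]
      rw [this, map_zero]
  rw [PiLp.zero_apply, ← hdiv]
  refine setIntegral_congr_fun hΩ.isOpen.measurableSet fun x hx => ?_
  have hxS : x ∈ S := subset_closure hx
  rw [Finset.sum_eq_single i]
  · simp only [if_true, ← hSdef]
    rw [partialDeriv_mul hS hxS (hu.differentiableOn (by simp)) (hφ1.differentiableOn (by simp))]
    change u x * partialDeriv S i φ x + φ x * partialDeriv S i u x = _
    ring
  · intro k _ hk
    simp [hk, partialDeriv]
  · simp

theorem lambda2_nonneg (Ω : Set (E d)) : 0 ≤ lambda2 Ω := by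
  refine Real.sInf_nonneg ?_
  rintro r ⟨u, G, -, -, -, rfl⟩
  exact div_nonneg (integral_nonneg fun x => by positivity) (integral_nonneg fun x => by positivity)

/-- The Poincaré inequality, for functions that are `C¹` up to the boundary. -/
theorem IsSmoothConvexDomain.lambda2_mul_le (hΩ : IsSmoothConvexDomain Ω) {u : E d → ℝ}
    (hu : ContDiffOn ℝ 1 u (closure Ω)) (h0 : ∫ x in Ω, u x = 0) :
    lambda2 Ω * ∫ x in Ω, u x ^ 2 ≤ ∫ x in Ω, gradSq (closure Ω) u x := by
  -- Functions with ∫ u² = 0 do not compete in the infimum; for them the left side is zero.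
  rcases (integral_nonneg fun x => sq_nonneg (u x) : 0 ≤ ∫ x in Ω, u x ^ 2).eq_or_lt' with h | h
  · rw [h, mul_zero]
    exact integral_nonneg fun x => gradSq_nonneg _ _ _
  · rw [← le_div_iff₀ h]
    refine csInf_le ⟨0, ?_⟩ ⟨u, gradVec (closure Ω) u, hΩ.memH1 hu, h0, h, ?_⟩
    · rintro r ⟨u, G, -, -, -, rfl⟩
      exact div_nonneg (integral_nonneg fun x => by positivity)
        (integral_nonneg fun x => by positivity)
    · simp only [norm_gradVec_sq]

/-- The spectral gap for the gradient: `λ₂ ∫ |∇v|² ≤ ∫ (Δv)²`. -/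
theorem NeumannCondition.lambda2_mul_integral_gradSq_le (hΩ : IsSmoothConvexDomain Ω)
    (hvol : volume Ω = 1) {v : E d → ℝ} (hv : NeumannCondition Ω v)
    (hvc : ContDiffOn ℝ 2 v (closure Ω)) :
    lambda2 Ω * ∫ x in Ω, gradSq (closure Ω) v x ≤ ∫ x in Ω, lap (closure Ω) v x ^ 2 := by
  have hS := hΩ.uniqueDiffOn
  set S := closure Ω with hSdef
  set m := ∫ x in Ω, v x with hm
  have hv1 : ContDiffOn ℝ 1 v S := hvc.of_le (by norm_num)
  have hw : ContDiffOn ℝ 1 (fun x => v x - m) S := hv1.sub contDiffOn_const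
  have hpd : ∀ i, ∀ x ∈ S, partialDeriv S i (fun x => v x - m) x = partialDeriv S i v x :=
    fun i x hx => by
      rw [partialDeriv_sub hS hx (hv1.differentiableOn (by simp)) (differentiableOn_const _)]
      simp [partialDeriv]
  have hlapc : ContinuousOn (lap S v) S :=
    (contDiffOn_lap (m := 0) hS hvc (by norm_num)).continuousOn
  have hTc : ContinuousOn (gradSq S v) S :=
    (contDiffOn_gradSq (m := 0) hS hv1 (by norm_num)).continuousOn
  have hmean : ∫ x in Ω, (v x - m) = 0 := by
    rw [integral_sub (hΩ.integrableOn hv1.continuousOn) (hΩ.integrableOn continuousOn_const)]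
    simp [Measure.real, hvol, ← hm]
  have hP := hΩ.lambda2_mul_le hw hmean
  have hT : ∫ x in Ω, gradSq S (fun x => v x - m) x = ∫ x in Ω, gradSq S v x :=
    setIntegral_congr_fun hΩ.isOpen.measurableSet fun x hx =>
      Finset.sum_congr rfl fun i _ => by rw [hpd i x (subset_closure hx)]
  rw [← hSdef, hT] at hP
  have hI := hv.integral_divergence hΩ hvc hw
  have hI' : ∫ x in Ω, (gradSq S v x + (v x - m) * lap S v x) = 0 := by
    rw [← hI]
    refine setIntegral_congr_fun hΩ.isOpen.measurableSet fun x hx => ?_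
    simp only [gradSq, lap, ← hSdef]
    congr 1
    exact Finset.sum_congr rfl fun i _ => by rw [hpd i x (subset_closure hx), sq]
  have hw2 : IntegrableOn (fun x => (v x - m) ^ 2) Ω := hΩ.integrableOn (hw.continuousOn.pow 2)
  have hl2 : IntegrableOn (fun x => lap S v x ^ 2) Ω := hΩ.integrableOn (hlapc.pow 2)
  have hwl : IntegrableOn (fun x => (v x - m) * lap S v x) Ω :=
    hΩ.integrableOn (hw.continuousOn.mul hlapc)
  rw [integral_add (hΩ.integrableOn hTc) hwl] at hI'
  set l := lambda2 Ω with hl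
  have hl0 : 0 ≤ l := lambda2_nonneg Ω
  -- With w = v - m and ∫ wΔv = -∫ |∇v|², this square gives 0 ≤ ∫ (Δv)² - 2λ₂ ∫ |∇v|² + λ₂² ∫ w².
  -- The Poincaré inequality for w bounds the last term by λ₂ ∫ |∇v|².
  have hsq : 0 ≤ ∫ x in Ω, (lap S v x + l * (v x - m)) ^ 2 := integral_nonneg fun x => sq_nonneg _
  have hexp : ∫ x in Ω, (lap S v x + l * (v x - m)) ^ 2 = (∫ x in Ω, lap S v x ^ 2) +
      2 * l * (∫ x in Ω, (v x - m) * lap S v x) + l ^ 2 * ∫ x in Ω, (v x - m) ^ 2 := by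
    rw [← integral_const_mul, ← integral_const_mul,
      ← integral_add hl2 (hwl.const_mul _), ← integral_add (Integrable.fun_add hl2 (hwl.const_mul _))
        (hw2.const_mul _)]
    refine integral_congr_ae (ae_of_all _ fun x => ?_)
    beta_reduce
    ring
  rw [hexp] at hsq
  nlinarith [mul_le_mul_of_nonneg_left hP hl0]

/-! ### The pointwise inequality and the decay estimate. -/

theorem sq_trace_le_card_mul_sum_sq (m : Fin d → Fin d → ℝ) :
    (∑ i, m i i) ^ 2 ≤ d * ∑ i, ∑ j, m i j ^ 2 := by
  have h1 : (∑ i, m i i) ^ 2 ≤ d * ∑ i, m i i ^ 2 := by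
    simpa using sq_sum_le_card_mul_sum_sq (s := Finset.univ) (f := fun i => m i i)
  refine h1.trans (mul_le_mul_of_nonneg_left (Finset.sum_le_sum fun i _ => ?_) (Nat.cast_nonneg d))
  exact Finset.single_le_sum (f := fun j => m i j ^ 2) (fun j _ => sq_nonneg _) (Finset.mem_univ i)

/-- This is the trace inequality for the matrix h - γ g⊗g, expanded. -/
theorem sq_trace_sub_le (h : Fin d → Fin d → ℝ) (g : Fin d → ℝ) (γ : ℝ) :
    (∑ i, h i i - γ * ∑ i, g i ^ 2) ^ 2 ≤ d * (∑ i, ∑ j, h i j ^ 2 -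
      2 * γ * ∑ i, ∑ j, h i j * g i * g j + γ ^ 2 * (∑ i, g i ^ 2) ^ 2) := by
  have h1 := sq_trace_le_card_mul_sum_sq fun i j => h i j - γ * (g i * g j)
  have e1 : ∑ i, (h i i - γ * (g i * g i)) = ∑ i, h i i - γ * ∑ i, g i ^ 2 := by
    rw [Finset.sum_sub_distrib, Finset.mul_sum]
    simp only [sq]
  have e2 : ∑ i, ∑ j, (h i j - γ * (g i * g j)) ^ 2 = ∑ i, ∑ j, h i j ^ 2 -
      2 * γ * ∑ i, ∑ j, h i j * g i * g j + γ ^ 2 * (∑ i, g i ^ 2) ^ 2 := by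
    rw [sq (∑ i, g i ^ 2), Finset.sum_mul_sum]
    simp only [Finset.mul_sum, ← Finset.sum_add_distrib, ← Finset.sum_sub_distrib]
    refine Finset.sum_congr rfl fun i _ => Finset.sum_congr rfl fun j _ => ?_
    ring
  rwa [e1, e2] at h1

/-- The pointwise inequality behind the decay estimate, with `L` the Laplacian, `T` the square of
the norm of the gradient, `H` the square of the norm of the Hessian, `Q` the Hessian applied to the
gradient, and `s` the inverse of the function. -/
theorem pointwise_quadratic_bound (hd : 1 ≤ d) {θ : ℝ} (hθ : 0 < θ) (p β : ℝ)
    (h : Fin d → Fin d → ℝ) (g : Fin d → ℝ) (s : ℝ) :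
    constR θ p d β * (∑ i, g i ^ 2) ^ 2 * s ^ 2 +
      θ * d / (d - 1) * ((∑ i, h i i) ^ 2 - ∑ i, ∑ j, h i j ^ 2) +
      (kappa p β + β - 1) * (d / (d + 2)) * (2 * s * ∑ i, ∑ j, h i j * g i * g j +
        s * (∑ i, g i ^ 2) * ∑ i, h i i - (∑ i, g i ^ 2) ^ 2 * s ^ 2) ≤
    θ * (∑ i, h i i) ^ 2 + (kappa p β + β - 1) * ((∑ i, h i i) * (∑ i, g i ^ 2) * s) +
      kappa p β * (β - 1) * (∑ i, g i ^ 2) ^ 2 * s ^ 2 := by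
  rw [constR]
  generalize kappa p β = κ
  set c := κ + β - 1 with hc
  -- For `d = 1` the weight `θ * d / (d - 1)` is zero by the convention on division by zero, and the
  -- two sides differ by `θ * h 0 0 ^ 2`.
  rcases hd.eq_or_lt with rfl | hd2
  · simp only [Finset.univ_unique, Fin.default_eq_zero, Fin.isValue, Finset.sum_singleton,
      Nat.cast_one, sub_self, div_zero, zero_mul, zero_div]
    have : 0 ≤ θ * h 0 0 ^ 2 := by positivity
    nlinarith
  · have hd1 : (0 : ℝ) < d - 1 := by
      have : (1 : ℝ) < d := by exact_mod_cast hd2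
      linarith
    have hd0 : (0 : ℝ) < d := by linarith
    -- This γ matches the coefficient of `Q`; the weight d/(d+2) then makes the coefficient of `L *
    -- T` match too. The remaining θγ²T² is the negative square term of `constR`.
    have key := sq_trace_sub_le h g (c * (d - 1) / (θ * (d + 2)) * s)
    set L := ∑ i, h i i
    set T := ∑ i, g i ^ 2
    set H := ∑ i, ∑ j, h i j ^ 2
    set Q := ∑ i, ∑ j, h i j * g i * g j
    rw [← sub_nonneg] at key ⊢
    have e : θ * L ^ 2 + c * (L * T * s) + κ * (β - 1) * T ^ 2 * s ^ 2 -
        ((-(1 / θ) * ((d - 1) / (d + 2)) ^ 2 * c ^ 2 + κ * (β - 1) + c * (d / (d + 2))) *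
          T ^ 2 * s ^ 2 + θ * d / (d - 1) * (L ^ 2 - H) +
          c * (d / (d + 2)) * (2 * s * Q + s * T * L - T ^ 2 * s ^ 2)) =
        θ / (d - 1) * (d * (H - 2 * (c * (d - 1) / (θ * (d + 2)) * s) * Q +
          (c * (d - 1) / (θ * (d + 2)) * s) ^ 2 * T ^ 2) -
          (L - c * (d - 1) / (θ * (d + 2)) * s * T) ^ 2) := by
      have hd2' : (d : ℝ) + 2 ≠ 0 := by positivity
      have := hd1.ne'
      field_simp
      ring
    rw [e]
    exact mul_nonneg (by positivity) key

/-- The decay estimate: `R ∫ |∇v|⁴/v²` is bounded by the entropy production. -/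
theorem NeumannCondition.constR_mul_integral_le (hd : 1 ≤ d) (hΩ : IsSmoothConvexDomain Ω)
    (hvol : volume Ω = 1) {v : E d → ℝ} (hv : NeumannCondition Ω v)
    (hvc : ContDiffOn ℝ 3 v (closure Ω)) (hpos : ∀ x ∈ closure Ω, 0 < v x)
    {θ : ℝ} (hθ0 : 0 < θ) (hθ1 : θ < 1) (p β : ℝ) {Λ : ℝ} (hΛ : Λ ≤ (1 - θ) * lambda2 Ω) :
    constR θ p d β * ∫ x in Ω, gradSq (closure Ω) v x ^ 2 / v x ^ 2 ≤
      (∫ x in Ω, (lap (closure Ω) v x + (β - 1) * (gradSq (closure Ω) v x / v x)) *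
        (lap (closure Ω) v x + kappa p β * (gradSq (closure Ω) v x / v x))) -
      Λ * ∫ x in Ω, gradSq (closure Ω) v x := by
  have hS := hΩ.uniqueDiffOn
  have hbochner := hv.integral_hessian_sq_le hΩ hvc
  have hgap := hv.lambda2_mul_integral_gradSq_le hΩ hvol (hvc.of_le (by norm_num))
  set S := closure Ω with hSdef
  have hv1 : ContDiffOn ℝ 1 v S := hvc.of_le (by norm_num)
  have hvd : DifferentiableOn ℝ v S := hv1.differentiableOn (by simp)
  have hne : ∀ x ∈ S, v x ≠ 0 := fun x hx => (hpos x hx).ne'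
  have hg2 : ∀ i, ContDiffOn ℝ 2 (partialDeriv S i v) S := fun i =>
    contDiffOn_partialDeriv hS hvc (by norm_num)
  have hgd : ∀ i, DifferentiableOn ℝ (partialDeriv S i v) S := fun i =>
    (hg2 i).differentiableOn (by simp)
  have hhc : ∀ i j, ContinuousOn (partialDeriv S j (partialDeriv S i v)) S := fun i j =>
    (contDiffOn_partialDeriv (m := 1) hS (hg2 i) (by norm_num)).continuousOn
  have hT1 : ContDiffOn ℝ 1 (gradSq S v) S := contDiffOn_gradSq hS hvc (by norm_num)
  have hTd : DifferentiableOn ℝ (gradSq S v) S := hT1.differentiableOn (by simp)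
  have hTc := hT1.continuousOn
  have hgc : ∀ i, ContinuousOn (partialDeriv S i v) S := fun i => (hg2 i).continuousOn
  have hlc : ContinuousOn (lap S v) S :=
    (contDiffOn_lap (m := 1) hS hvc (by norm_num)).continuousOn
  have hinv : ContDiffOn ℝ 1 (fun x => (v x)⁻¹) S := hv1.inv hne
  have hinvd : DifferentiableOn ℝ (fun x => (v x)⁻¹) S := hinv.differentiableOn (by simp)
  have hic := hinv.continuousOn
  let H : E d → ℝ := fun x => ∑ i, ∑ j, partialDeriv S j (partialDeriv S i v) x ^ 2
  let Q : E d → ℝ := fun x => ∑ i, ∑ j, partialDeriv S j (partialDeriv S i v) x *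
    partialDeriv S i v x * partialDeriv S j v x
  have hHc : ContinuousOn H S := continuousOn_finsetSum _ fun i _ =>
    continuousOn_finsetSum _ fun j _ => (hhc i j).pow 2
  have hQc : ContinuousOn Q S := continuousOn_finsetSum _ fun i _ =>
    continuousOn_finsetSum _ fun j _ => ((hhc i j).mul (hgc i)).mul (hgc j)
  -- `∫ div (|∇v|² ∇v / v) = 0`
  let D : E d → ℝ := fun x => 2 * (v x)⁻¹ * Q x + (v x)⁻¹ * gradSq S v x * lap S v x -
    gradSq S v x ^ 2 * (v x)⁻¹ ^ 2
  have hD : ∫ x in Ω, D x = 0 := by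
    rw [← hv.integral_divergence hΩ (hvc.of_le (by norm_num)) (hT1.mul hinv)]
    refine setIntegral_congr_fun hΩ.isOpen.measurableSet fun x hx => ?_
    have hxS : x ∈ S := subset_closure hx
    have e1 : ∀ i, partialDeriv S i (gradSq S v) x = ∑ j,
        2 * (partialDeriv S i (partialDeriv S j v) x * partialDeriv S j v x) := fun i => by
      have : gradSq S v = fun z => ∑ j, partialDeriv S j v z * partialDeriv S j v z := by
        ext z
        simp only [gradSq, sq]
      rw [this, partialDeriv_sum hS hxS fun j _ => (hgd j).fun_mul (hgd j)]
      refine Finset.sum_congr rfl fun j _ => ?_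
      rw [partialDeriv_mul hS hxS (hgd j) (hgd j)]
      ring
    have e2 : ∀ i, partialDeriv S i (fun z => (v z)⁻¹) x =
        -(v x ^ 2)⁻¹ * partialDeriv S i v x := fun i =>
      partialDeriv_comp hS hxS hvd (hasDerivAt_inv (hne x hxS))
    have e3 : ∀ i, partialDeriv S i (fun z => gradSq S v z * (v z)⁻¹) x =
        (∑ j, 2 * (partialDeriv S i (partialDeriv S j v) x * partialDeriv S j v x)) * (v x)⁻¹ +
        gradSq S v x * (-(v x ^ 2)⁻¹ * partialDeriv S i v x) := fun i => by
      rw [partialDeriv_mul hS hxS hTd hinvd, e1, e2]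
    change D x = (∑ i, partialDeriv S i (fun z => gradSq S v z * (v z)⁻¹) x *
      partialDeriv S i v x) + gradSq S v x * (v x)⁻¹ * lap S v x
    simp only [e3, add_mul, Finset.sum_add_distrib]
    have e4 : ∑ i, (∑ j, 2 * (partialDeriv S i (partialDeriv S j v) x * partialDeriv S j v x)) *
        (v x)⁻¹ * partialDeriv S i v x = 2 * (v x)⁻¹ * Q x := by
      simp only [Q, Finset.mul_sum, Finset.sum_mul]
      rw [Finset.sum_comm]
      refine Finset.sum_congr rfl fun i _ => Finset.sum_congr rfl fun j _ => ?_
      ring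
    have e5 : ∑ i, gradSq S v x * (-(v x ^ 2)⁻¹ * partialDeriv S i v x) * partialDeriv S i v x =
        -(gradSq S v x ^ 2 * (v x)⁻¹ ^ 2) := by
      have : ∀ i, gradSq S v x * (-(v x ^ 2)⁻¹ * partialDeriv S i v x) * partialDeriv S i v x =
          (-(v x)⁻¹ ^ 2 * gradSq S v x) * partialDeriv S i v x ^ 2 := fun i => by
        rw [← inv_pow]
        ring
      simp only [this, ← Finset.mul_sum]
      rw [← gradSq]
      ring
    rw [e4, e5]
    simp only [D]
    ring
  have hDc : ContinuousOn D S :=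
    (((continuousOn_const.mul hic).mul hQc).add ((hic.mul hTc).mul hlc)).sub
      ((hTc.pow 2).mul (hic.pow 2))
  set c := kappa p β + β - 1 with hcdef
  set k := θ * d / ((d : ℝ) - 1) with hk
  have hk0 : 0 ≤ k := by
    have : (1 : ℝ) ≤ d := by exact_mod_cast hd
    exact div_nonneg (by positivity) (by linarith)
  have i1 : IntegrableOn (fun x => gradSq S v x ^ 2 / v x ^ 2) Ω :=
    hΩ.integrableOn ((hTc.pow 2).div (hv1.continuousOn.pow 2) fun x hx => pow_ne_zero 2 (hne x hx))
  have i2 : IntegrableOn (fun x => lap S v x ^ 2 - H x) Ω := hΩ.integrableOn ((hlc.pow 2).sub hHc)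
  have i3 : IntegrableOn D Ω := hΩ.integrableOn hDc
  have hTv : ContinuousOn (fun x => gradSq S v x / v x) S := hTc.div hv1.continuousOn hne
  have i4 : IntegrableOn (fun x => (lap S v x + (β - 1) * (gradSq S v x / v x)) *
      (lap S v x + kappa p β * (gradSq S v x / v x))) Ω :=
    hΩ.integrableOn ((hlc.add (continuousOn_const.mul hTv)).mul
      (hlc.add (continuousOn_const.mul hTv)))
  have i5 : IntegrableOn (fun x => lap S v x ^ 2) Ω := hΩ.integrableOn (hlc.pow 2)
  -- The part (1-θ)(Δv)² is set aside for the spectral gap; the pointwise bound uses only θ(Δv)².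
  have hmain : ∫ x in Ω, (constR θ p d β * (gradSq S v x ^ 2 / v x ^ 2) +
      k * (lap S v x ^ 2 - H x) + c * (d / (d + 2)) * D x) ≤
      ∫ x in Ω, ((lap S v x + (β - 1) * (gradSq S v x / v x)) *
        (lap S v x + kappa p β * (gradSq S v x / v x)) - (1 - θ) * lap S v x ^ 2) := by
    refine setIntegral_mono_on (((i1.const_mul _).fun_add (i2.const_mul _)).fun_add
      (i3.const_mul _)) (i4.fun_sub (i5.const_mul _)) hΩ.isOpen.measurableSet fun x hx => ?_
    have hb := pointwise_quadratic_bound hd hθ0 p β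
      (fun i j => partialDeriv S j (partialDeriv S i v) x) (fun i => partialDeriv S i v x) (v x)⁻¹
    calc _ = constR θ p d β * gradSq S v x ^ 2 * (v x)⁻¹ ^ 2 + k * (lap S v x ^ 2 - H x) +
          c * (d / (d + 2)) * D x := by
          rw [div_eq_mul_inv, inv_pow]
          ring
      _ ≤ θ * lap S v x ^ 2 + c * (lap S v x * gradSq S v x * (v x)⁻¹) +
          kappa p β * (β - 1) * gradSq S v x ^ 2 * (v x)⁻¹ ^ 2 := hb
      _ = _ := by
          rw [div_eq_mul_inv, hcdef]
          ring
  rw [integral_add ((i1.const_mul _).fun_add (i2.const_mul _)) (i3.const_mul _),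
    integral_add (i1.const_mul _) (i2.const_mul _), integral_sub i4 (i5.const_mul _),
    integral_const_mul, integral_const_mul, integral_const_mul, integral_const_mul, hD] at hmain
  have hb' : 0 ≤ k * ∫ x in Ω, (lap S v x ^ 2 - H x) := mul_nonneg hk0 hbochner
  have hT0 : 0 ≤ ∫ x in Ω, gradSq S v x := integral_nonneg fun x => gradSq_nonneg _ _ _
  have h1 := mul_le_mul_of_nonneg_right hΛ hT0
  have h2 := mul_le_mul_of_nonneg_left hgap (sub_nonneg.2 hθ1.le)
  linarith

/-! ### Differentiation under the integral sign. -/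

/-- Convergence of weighted integrals of difference quotients. -/
theorem IsSmoothConvexDomain.tendsto_integral_slope_mul (hΩ : IsSmoothConvexDomain Ω) {I : Set ℝ}
    (hI : Convex ℝ I) {h h' m : ℝ → E d → ℝ} {C M t : ℝ} (ht : t ∈ I)
    (hder : ∀ s ∈ I, ∀ x ∈ Ω, HasDerivWithinAt (fun s => h s x) (h' s x) I s)
    (hC : ∀ s ∈ I, ∀ x ∈ Ω, ‖h' s x‖ ≤ C) (hM : ∀ s ∈ I, ∀ x ∈ Ω, ‖m s x‖ ≤ M)
    (hhc : ∀ s ∈ I, ContinuousOn (h s) Ω) (hmc : ∀ s ∈ I, ContinuousOn (m s) Ω)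
    (hmt : ∀ x ∈ Ω, ContinuousWithinAt (fun s => m s x) I t) :
    Tendsto (fun s => ∫ x in Ω, (s - t)⁻¹ * (h s x - h t x) * m s x) (𝓝[I \ {t}] t)
      (𝓝 (∫ x in Ω, h' t x * m t x)) := by
  have hfin : IsFiniteMeasure (volume.restrict Ω) :=
    ⟨by simpa using hΩ.isBounded.measure_lt_top⟩
  have hmem : ∀ᶠ s in 𝓝[I \ {t}] t, s ∈ I \ {t} := self_mem_nhdsWithin
  refine tendsto_integral_filter_of_dominated_convergence (fun _ => C * M) ?_ ?_
    (integrable_const _) ?_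
  · filter_upwards [hmem] with s hs
    exact ((continuousOn_const.mul ((hhc s hs.1).sub (hhc t ht))).mul
      (hmc s hs.1)).aestronglyMeasurable hΩ.isOpen.measurableSet
  · filter_upwards [hmem] with s hs
    filter_upwards [ae_restrict_mem hΩ.isOpen.measurableSet] with x hx
    have hst : 0 < ‖s - t‖ := norm_pos_iff.2 (sub_ne_zero.2 hs.2)
    -- The mean value inequality on the interval bounds every difference quotient by `C`, whence the
    -- dominating constant `C * M`.
    have h1 := hI.norm_image_sub_le_of_norm_hasDerivWithin_le (fun s hs => hder s hs x hx)
      (fun s hs => hC s hs x hx) ht hs.1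
    have h2 : ‖(s - t)⁻¹ * (h s x - h t x)‖ ≤ C := by
      rw [norm_mul, norm_inv, inv_mul_le_iff₀ hst, mul_comm]
      exact h1
    rw [norm_mul]
    exact mul_le_mul h2 (hM s hs.1 x hx) (norm_nonneg _) ((norm_nonneg _).trans h2)
  · filter_upwards [ae_restrict_mem hΩ.isOpen.measurableSet] with x hx
    have h1 := hasDerivWithinAt_iff_tendsto_slope.1 (hder t ht x hx)
    exact h1.mul ((hmt x hx).mono_left (nhdsWithin_mono _ sdiff_subset))

/-- Differentiation under the integral sign, one-sided at the end points. -/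
theorem IsSmoothConvexDomain.hasDerivWithinAt_integral (hΩ : IsSmoothConvexDomain Ω) {I : Set ℝ}
    (hI : Convex ℝ I) {h h' : ℝ → E d → ℝ} {C t : ℝ} (ht : t ∈ I)
    (hder : ∀ s ∈ I, ∀ x ∈ Ω, HasDerivWithinAt (fun s => h s x) (h' s x) I s)
    (hC : ∀ s ∈ I, ∀ x ∈ Ω, ‖h' s x‖ ≤ C) (hhc : ∀ s ∈ I, ContinuousOn (h s) (closure Ω)) :
    HasDerivWithinAt (fun s => ∫ x in Ω, h s x) (∫ x in Ω, h' t x) I t := by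
  have key := hΩ.tendsto_integral_slope_mul hI (m := fun _ _ => 1) (M := 1) ht hder hC
    (fun _ _ _ _ => by simp) (fun s hs => (hhc s hs).mono subset_closure)
    (fun _ _ => continuousOn_const) fun _ _ => continuousWithinAt_const
  simp only [mul_one] at key
  rw [hasDerivWithinAt_iff_tendsto_slope]
  refine key.congr' ?_
  filter_upwards [self_mem_nhdsWithin] with s hs
  rw [integral_const_mul, integral_sub (hΩ.integrableOn (hhc s hs.1)) (hΩ.integrableOn (hhc t ht))]
  rfl

/-! ### Powers of positive functions and differences of Dirichlet energies. -/

section Rpow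

variable {S : Set (E d)} {f : E d → ℝ} {x : E d}

theorem contDiffOn_rpow {n : ℕ∞ω} (hf : ContDiffOn ℝ n f S) (hpos : ∀ x ∈ S, 0 < f x) (q : ℝ) :
    ContDiffOn ℝ n (fun x => f x ^ q) S :=
  hf.rpow_const_of_ne fun x hx => (hpos x hx).ne'

theorem partialDeriv_rpow (hS : UniqueDiffOn ℝ S) (hx : x ∈ S) (hf : DifferentiableOn ℝ f S)
    (hpos : ∀ x ∈ S, 0 < f x) (q : ℝ) (i : Fin d) :
    partialDeriv S i (fun z => f z ^ q) x = q * f x ^ (q - 1) * partialDeriv S i f x :=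
  partialDeriv_comp hS hx hf (Real.hasDerivAt_rpow_const (Or.inl (hpos x hx).ne'))

/-- With q = β this produces the factor Δv + (β-1)|∇v|²/v of the entropy production. -/
theorem lap_rpow (hS : UniqueDiffOn ℝ S) (hx : x ∈ S) (hf : ContDiffOn ℝ 2 f S)
    (hpos : ∀ x ∈ S, 0 < f x) (q : ℝ) :
    lap S (fun z => f z ^ q) x =
      q * f x ^ (q - 1) * (lap S f x + (q - 1) * (gradSq S f x / f x)) := by
  have hfd : DifferentiableOn ℝ f S := hf.differentiableOn (by simp)
  have hg : ∀ i, DifferentiableOn ℝ (partialDeriv S i f) S := fun i =>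
    (contDiffOn_partialDeriv (m := 1) hS hf (by norm_num)).differentiableOn (by simp)
  have hr : DifferentiableOn ℝ (fun z => f z ^ (q - 1)) S :=
    (contDiffOn_rpow hf hpos (q - 1)).differentiableOn (by simp)
  have e : ∀ i, partialDeriv S i (partialDeriv S i fun z => f z ^ q) x =
      q * f x ^ (q - 1) * (partialDeriv S i (partialDeriv S i f) x +
        (q - 1) * (f x)⁻¹ * partialDeriv S i f x ^ 2) := fun i => by
    rw [partialDeriv_congr (g := fun z => q * (f z ^ (q - 1) * partialDeriv S i f z)) hx fun z hz =>
      (partialDeriv_rpow hS hz hfd hpos q i).trans (mul_assoc _ _ _),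
      partialDeriv_mul hS hx (differentiableOn_const q) (hr.fun_mul (hg i)),
      partialDeriv_mul hS hx hr (hg i), partialDeriv_rpow hS hx hfd hpos,
      Real.rpow_sub_one (hpos x hx).ne' (q - 1)]
    have : partialDeriv S i (fun _ => q) x = 0 := by simp [partialDeriv]
    rw [this]
    ring
  simp only [lap, e, ← Finset.mul_sum, Finset.sum_add_distrib, gradSq]
  ring

end Rpow

theorem NeumannCondition.rpow (hΩ : IsSmoothConvexDomain Ω) {v : E d → ℝ}
    (hv : NeumannCondition Ω v) (hvd : DifferentiableOn ℝ v (closure Ω))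
    (hpos : ∀ x ∈ closure Ω, 0 < v x) (q : ℝ) : NeumannCondition Ω fun x => v x ^ q := by
  intro y hy n hn
  have hyS := frontier_subset_closure hy
  have h1 := (Real.hasDerivAt_rpow_const (p := q) (Or.inl (hpos y hyS).ne')).comp_hasFDerivWithinAt
    y (hvd y hyS).hasFDerivWithinAt
  change fderivWithin ℝ ((fun z : ℝ => z ^ q) ∘ v) (closure Ω) y n = 0
  rw [h1.fderivWithin (hΩ.uniqueDiffOn y hyS)]
  simp [hv y hy n hn]

theorem NeumannCondition.add (hΩ : IsSmoothConvexDomain Ω) {v w : E d → ℝ}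
    (hv : NeumannCondition Ω v) (hw : NeumannCondition Ω w)
    (hvd : DifferentiableOn ℝ v (closure Ω)) (hwd : DifferentiableOn ℝ w (closure Ω)) :
    NeumannCondition Ω fun x => v x + w x := by
  intro y hy n hn
  have hyS := frontier_subset_closure hy
  rw [fderivWithin_fun_add (hΩ.uniqueDiffOn y hyS) (hvd y hyS) (hwd y hyS)]
  simp [hv y hy n hn, hw y hy n hn]

theorem lap_add {S : Set (E d)} {f g : E d → ℝ} {x : E d} (hS : UniqueDiffOn ℝ S) (hx : x ∈ S)
    (hf : ContDiffOn ℝ 2 f S) (hg : ContDiffOn ℝ 2 g S) :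
    lap S (fun z => f z + g z) x = lap S f x + lap S g x := by
  simp only [lap, ← Finset.sum_add_distrib]
  refine Finset.sum_congr rfl fun i _ => ?_
  rw [partialDeriv_congr (g := fun z => partialDeriv S i f z + partialDeriv S i g z) hx fun z hz =>
    partialDeriv_add hS hz (hf.differentiableOn (by simp)) (hg.differentiableOn (by simp))]
  exact partialDeriv_add hS hx
    ((contDiffOn_partialDeriv (m := 1) hS hf (by norm_num)).differentiableOn (by simp))
    ((contDiffOn_partialDeriv (m := 1) hS hg (by norm_num)).differentiableOn (by simp))

/-- The difference of two Dirichlet energies, by integration by parts. -/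
theorem NeumannCondition.integral_gradSq_sub (hΩ : IsSmoothConvexDomain Ω) {v w : E d → ℝ}
    (hv : NeumannCondition Ω v) (hw : NeumannCondition Ω w)
    (hvc : ContDiffOn ℝ 2 v (closure Ω)) (hwc : ContDiffOn ℝ 2 w (closure Ω)) :
    (∫ x in Ω, gradSq (closure Ω) v x) - ∫ x in Ω, gradSq (closure Ω) w x =
      -∫ x in Ω, (v x - w x) * (lap (closure Ω) v x + lap (closure Ω) w x) := by
  have hS := hΩ.uniqueDiffOn
  have hvd : DifferentiableOn ℝ v (closure Ω) := hvc.differentiableOn (by simp)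
  have hwd : DifferentiableOn ℝ w (closure Ω) := hwc.differentiableOn (by simp)
  have hTv := (contDiffOn_gradSq (m := 0) hS hvc (by norm_num)).continuousOn
  have hTw := (contDiffOn_gradSq (m := 0) hS hwc (by norm_num)).continuousOn
  have hLv := (contDiffOn_lap (m := 0) hS hvc (by norm_num)).continuousOn
  have hLw := (contDiffOn_lap (m := 0) hS hwc (by norm_num)).continuousOn
  have i1 : IntegrableOn (fun x => (v x - w x) * (lap (closure Ω) v x + lap (closure Ω) w x)) Ω :=
    hΩ.integrableOn ((hvc.continuousOn.sub hwc.continuousOn).mul (hLv.add hLw))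
  -- The identity |∇v|² - |∇w|² = ∇(v-w)·∇(v+w) is integrated by parts, with the Neumann condition
  -- of v + w.
  rw [← integral_sub (hΩ.integrableOn hTv) (hΩ.integrableOn hTw), eq_neg_iff_add_eq_zero,
    ← integral_add ((hΩ.integrableOn hTv).fun_sub (hΩ.integrableOn hTw)) i1,
    ← (hv.add hΩ hw hvd hwd).integral_divergence hΩ (hvc.add hwc)
      ((hvc.sub hwc).of_le (by norm_num : (1 : ℕ∞ω) ≤ 2))]
  refine setIntegral_congr_fun hΩ.isOpen.measurableSet fun x hx => ?_
  have hxS := subset_closure hx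
  change _ = (∑ i, partialDeriv (closure Ω) i (fun z => v z - w z) x *
    partialDeriv (closure Ω) i (fun z => v z + w z) x) +
    (v x - w x) * lap (closure Ω) (fun z => v z + w z) x
  rw [lap_add hS hxS hvc hwc]
  congr 1
  rw [gradSq, gradSq, ← Finset.sum_sub_distrib]
  refine Finset.sum_congr rfl fun i _ => ?_
  rw [partialDeriv_sub hS hxS hvd hwd, partialDeriv_add hS hxS hvd hwd]
  ring

/-! ### Derivatives of the integrals along the flow. -/

variable {p β : ℝ} {I : Set ℝ} {v : ℝ → E d → ℝ}

theorem IsFlowSolution.mono (hv : IsFlowSolution Ω p β I v) {J : Set ℝ} (hJ : J ⊆ I) :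
    IsFlowSolution Ω p β J v where
  pos t ht := hv.pos t (hJ ht)
  contDiffOn t ht := hv.contDiffOn t (hJ ht)
  continuousOn k hk := (hv.continuousOn k hk).mono (prod_mono hJ subset_rfl)
  equation t ht x hx := (hv.equation t (hJ ht) x hx).mono hJ
  neumann t ht := hv.neumann t (hJ ht)

/-- The right-hand side of the flow equation. -/
noncomputable def flowSpeed (S : Set (E d)) (p β : ℝ) (f : E d → ℝ) (x : E d) : ℝ :=
  f x ^ (2 - 2 * β) * (lap S f x + kappa p β * (gradSq S f x / f x))

namespace IsFlowSolution

variable (hΩ : IsSmoothConvexDomain Ω) (hv : IsFlowSolution Ω p β I v)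
include hv

theorem continuousOn_val : ContinuousOn (fun z : ℝ × E d => v z.1 z.2) (I ×ˢ closure Ω) := by
  have h := (ContinuousMultilinearMap.apply ℝ (fun _ : Fin 0 => E d) ℝ
    (fun _ => 0)).continuous.comp_continuousOn (hv.continuousOn 0 (by norm_num))
  refine h.congr fun z _ => ?_
  simp

include hΩ

theorem continuousOn_partialDeriv (i : Fin d) :
    ContinuousOn (fun z : ℝ × E d => partialDeriv (closure Ω) i (v z.1) z.2)
      (I ×ˢ closure Ω) := by
  have h := (ContinuousMultilinearMap.apply ℝ (fun _ : Fin 1 => E d) ℝ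
    (fun _ => EuclideanSpace.single i 1)).continuous.comp_continuousOn
      (hv.continuousOn 1 (by norm_num))
  refine h.congr fun z hz => ?_
  simp [iteratedFDerivWithin_one_apply (hΩ.uniqueDiffOn z.2 hz.2), partialDeriv]

theorem continuousOn_gradSq :
    ContinuousOn (fun z : ℝ × E d => gradSq (closure Ω) (v z.1) z.2) (I ×ˢ closure Ω) :=
  continuousOn_finsetSum _ fun i _ => (hv.continuousOn_partialDeriv hΩ i).pow 2

theorem continuousOn_lap :
    ContinuousOn (fun z : ℝ × E d => lap (closure Ω) (v z.1) z.2) (I ×ˢ closure Ω) := by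
  refine continuousOn_finsetSum _ fun i _ => ?_
  have h := (ContinuousMultilinearMap.apply ℝ (fun _ : Fin 2 => E d) ℝ
    (fun _ => EuclideanSpace.single i 1)).continuous.comp_continuousOn
      (hv.continuousOn 2 le_rfl)
  refine h.congr fun z hz => ?_
  rw [partialDeriv_partialDeriv hΩ.uniqueDiffOn hz.2
    ((hv.contDiffOn z.1 hz.1).of_le (by norm_num))]
  simp [iteratedFDerivWithin_two_apply _ hΩ.uniqueDiffOn hz.2]

omit hΩ in
theorem continuousOn_rpow (q : ℝ) :
    ContinuousOn (fun z : ℝ × E d => v z.1 z.2 ^ q) (I ×ˢ closure Ω) :=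
  hv.continuousOn_val.rpow_const fun z hz => Or.inl (hv.pos z.1 hz.1 z.2 hz.2).ne'

theorem continuousOn_gradSq_div :
    ContinuousOn (fun z : ℝ × E d => gradSq (closure Ω) (v z.1) z.2 / v z.1 z.2)
      (I ×ˢ closure Ω) :=
  (hv.continuousOn_gradSq hΩ).div hv.continuousOn_val fun z hz => (hv.pos z.1 hz.1 z.2 hz.2).ne'

theorem continuousOn_flowSpeed :
    ContinuousOn (fun z : ℝ × E d => flowSpeed (closure Ω) p β (v z.1) z.2) (I ×ˢ closure Ω) :=
  (hv.continuousOn_rpow _).mul ((hv.continuousOn_lap hΩ).add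
    (continuousOn_const.mul (hv.continuousOn_gradSq_div hΩ)))

theorem hasDerivWithinAt_rpow (q : ℝ) {t : ℝ} (ht : t ∈ I) {x : E d} (hx : x ∈ Ω) :
    HasDerivWithinAt (fun s => v s x ^ q)
      (q * v t x ^ (q - 1) * flowSpeed (closure Ω) p β (v t) x) I t := by
  have h := (hv.equation t ht x hx).rpow_const (p := q)
    (Or.inl (hv.pos t ht x (subset_closure hx)).ne')
  rw [laplacian_eq_lap hΩ.uniqueDiffOn (hΩ.closure_mem_nhds hx)
    ((hv.contDiffOn t ht).of_le (by norm_num)), norm_gradient_sq (hΩ.closure_mem_nhds hx)] at h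
  convert! h using 1
  rw [flowSpeed]
  ring

omit hΩ in
-- For q = β(p+1), 2β and β the resulting power of v is κ, 1 and 1-β. These give a divergence, a
-- multiple of |∇v|² up to a divergence, and the cancellation of the factor v^(β-1) of Δ(v^β).
theorem rpow_mul_flowSpeed {t : ℝ} (ht : t ∈ I) (q : ℝ) {x : E d} (hx : x ∈ closure Ω) :
    v t x ^ (q - 1) * flowSpeed (closure Ω) p β (v t) x = v t x ^ (q + 1 - 2 * β) *
      (lap (closure Ω) (v t) x + kappa p β * (gradSq (closure Ω) (v t) x / v t x)) := by
  rw [flowSpeed, ← mul_assoc, ← Real.rpow_add (hv.pos t ht x hx)]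
  ring_nf

/-- Compactness of the time interval supplies the domination needed for differentiating under the
integral. -/
theorem exists_bound (hI : IsCompact I) (q : ℝ) : ∃ C, ∀ s ∈ I, ∀ x ∈ Ω,
    ‖q * v s x ^ (q - 1) * flowSpeed (closure Ω) p β (v s) x‖ ≤ C := by
  obtain ⟨C, hC⟩ := (hI.prod hΩ.isCompact).exists_bound_of_continuousOn
    ((continuousOn_const.mul (hv.continuousOn_rpow (q - 1))).mul (hv.continuousOn_flowSpeed hΩ))
  exact ⟨C, fun s hs x hx => hC (s, x) ⟨hs, subset_closure hx⟩⟩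

theorem hasDerivWithinAt_integral_rpow (hI : IsCompact I) (hIc : Convex ℝ I) (q : ℝ) {t : ℝ}
    (ht : t ∈ I) : HasDerivWithinAt (fun s => ∫ x in Ω, v s x ^ q)
      (∫ x in Ω, q * v t x ^ (q - 1) * flowSpeed (closure Ω) p β (v t) x) I t := by
  obtain ⟨C, hC⟩ := hv.exists_bound hΩ hI q
  exact hΩ.hasDerivWithinAt_integral hIc ht (fun s hs x hx => hv.hasDerivWithinAt_rpow hΩ q hs hx)
    hC fun s hs => (contDiffOn_rpow (hv.contDiffOn s hs) (hv.pos s hs) q).continuousOn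

/-- The `L^{p+1}` norm of `v^β` is conserved. -/
theorem hasDerivWithinAt_integral_rpow_succ (hI : IsCompact I) (hIc : Convex ℝ I) {t : ℝ}
    (ht : t ∈ I) : HasDerivWithinAt (fun s => ∫ x in Ω, v s x ^ (β * (p + 1))) 0 I t := by
  convert hv.hasDerivWithinAt_integral_rpow hΩ hI hIc (β * (p + 1)) ht using 1
  have hv3 := hv.contDiffOn t ht
  have hpos := hv.pos t ht
  -- The integrand is a constant times v^κ(Δv + κ|∇v|²/v) = div(v^κ ∇v).
  have hdiv := (hv.neumann t ht).integral_divergence hΩ (hv3.of_le (by norm_num))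
    (contDiffOn_rpow (hv3.of_le (by norm_num : (1 : ℕ∞ω) ≤ 3)) hpos (kappa p β))
  rw [← mul_zero (β * (p + 1)), ← hdiv, ← integral_const_mul]
  refine setIntegral_congr_fun hΩ.isOpen.measurableSet fun x hx => ?_
  have hxS := subset_closure hx
  rw [mul_assoc (β * (p + 1)), hv.rpow_mul_flowSpeed ht _ hxS]
  have e : β * (p + 1) + 1 - 2 * β = kappa p β := by
    rw [kappa]
    ring
  simp only [partialDeriv_rpow hΩ.uniqueDiffOn hxS (hv3.differentiableOn (by simp)) hpos]
  rw [e]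
  congr 1
  have e2 : ∑ i, kappa p β * v t x ^ (kappa p β - 1) * partialDeriv (closure Ω) i (v t) x *
      partialDeriv (closure Ω) i (v t) x =
      kappa p β * v t x ^ (kappa p β - 1) * gradSq (closure Ω) (v t) x := by
    rw [gradSq, Finset.mul_sum]
    exact Finset.sum_congr rfl fun i _ => by ring
  rw [e2, Real.rpow_sub_one (hpos x hxS).ne', lap]
  ring

/-- Here vΔv + κ|∇v|² = div(v∇v) + (κ-1)|∇v|² and κ - 1 = β(p-1). The factor p - 1 later cancels the
denominator in the functional. -/
theorem hasDerivWithinAt_integral_sq (hI : IsCompact I) (hIc : Convex ℝ I) {t : ℝ}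
    (ht : t ∈ I) : HasDerivWithinAt (fun s => ∫ x in Ω, v s x ^ (β * 2))
      (2 * β ^ 2 * (p - 1) * ∫ x in Ω, gradSq (closure Ω) (v t) x) I t := by
  convert hv.hasDerivWithinAt_integral_rpow hΩ hI hIc (β * 2) ht using 1
  have hv3 := hv.contDiffOn t ht
  have hpos := hv.pos t ht
  have hS := hΩ.uniqueDiffOn
  have hv1 : ContDiffOn ℝ 1 (v t) (closure Ω) := hv3.of_le (by norm_num)
  have hdiv : ∫ x in Ω, (gradSq (closure Ω) (v t) x + v t x * lap (closure Ω) (v t) x) = 0 := by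
    rw [← (hv.neumann t ht).integral_divergence hΩ (hv3.of_le (by norm_num)) hv1]
    simp only [gradSq, sq, lap]
  have hTc : IntegrableOn (gradSq (closure Ω) (v t)) Ω :=
    hΩ.integrableOn (contDiffOn_gradSq (m := 0) hS hv1 (by norm_num)).continuousOn
  have hLc := (contDiffOn_lap (m := 1) hS hv3 (by norm_num)).continuousOn
  have hvL : IntegrableOn (fun x => v t x * lap (closure Ω) (v t) x) Ω :=
    hΩ.integrableOn (hv1.continuousOn.mul hLc)
  have e : ∫ x in Ω, β * 2 * v t x ^ (β * 2 - 1) * flowSpeed (closure Ω) p β (v t) x =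
      ∫ x in Ω, (2 * β * (gradSq (closure Ω) (v t) x + v t x * lap (closure Ω) (v t) x) +
        2 * β ^ 2 * (p - 1) * gradSq (closure Ω) (v t) x) := by
    refine setIntegral_congr_fun hΩ.isOpen.measurableSet fun x hx => ?_
    have hxS := subset_closure hx
    have hne := (hpos x hxS).ne'
    rw [mul_assoc (β * 2), hv.rpow_mul_flowSpeed ht _ hxS]
    have e1 : β * 2 + 1 - 2 * β = 1 := by ring
    rw [e1, Real.rpow_one, kappa]
    field_simp
    ring
  rw [e, integral_add ((hTc.fun_add hvL).const_mul _) (hTc.const_mul _), integral_const_mul, hdiv,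
    integral_const_mul]
  ring

/-- No time derivative of ∇v is assumed. `integral_gradSq_sub` rewrites the increment of the energy
as -∫ (u(s)-u(t))(Δu(s)+Δu(t)), so the time derivative of u and the continuity of Δu suffice. -/
theorem hasDerivWithinAt_integral_gradSq (hI : IsCompact I) (hIc : Convex ℝ I) {t : ℝ}
    (ht : t ∈ I) :
    HasDerivWithinAt (fun s => ∫ x in Ω, gradSq (closure Ω) (fun x => v s x ^ β) x)
      (-(2 * β ^ 2) * ∫ x in Ω,
        (lap (closure Ω) (v t) x + (β - 1) * (gradSq (closure Ω) (v t) x / v t x)) *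
        (lap (closure Ω) (v t) x + kappa p β * (gradSq (closure Ω) (v t) x / v t x))) I t := by
  have hS := hΩ.uniqueDiffOn
  set S := closure Ω with hSdef
  have hu : ∀ s ∈ I, ContDiffOn ℝ 2 (fun x => v s x ^ β) S := fun s hs =>
    contDiffOn_rpow ((hv.contDiffOn s hs).of_le (by norm_num)) (hv.pos s hs) β
  have hlu : ∀ s ∈ I, ∀ x ∈ S, lap S (fun x => v s x ^ β) x =
      β * v s x ^ (β - 1) * (lap S (v s) x + (β - 1) * (gradSq S (v s) x / v s x)) :=
    fun s hs x hx => lap_rpow hS hx ((hv.contDiffOn s hs).of_le (by norm_num)) (hv.pos s hs) β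
  have hluc : ContinuousOn (fun z : ℝ × E d => lap S (fun x => v z.1 x ^ β) z.2) (I ×ˢ S) :=
    ((continuousOn_const.mul (hv.continuousOn_rpow (β - 1))).mul ((hv.continuousOn_lap hΩ).add
      (continuousOn_const.mul (hv.continuousOn_gradSq_div hΩ)))).congr
      fun z hz => hlu z.1 hz.1 z.2 hz.2
  have hlx : ∀ s ∈ I, ContinuousOn (lap S fun x => v s x ^ β) S := fun s hs =>
    (contDiffOn_lap (m := 0) hS (hu s hs) (by norm_num)).continuousOn
  have hlt : ∀ x ∈ S, ContinuousOn (fun s => lap S (fun x => v s x ^ β) x) I := fun x hx =>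
    hluc.comp (f := fun s => (s, x)) (by fun_prop) fun s hs => ⟨hs, hx⟩
  obtain ⟨C, hC⟩ := hv.exists_bound hΩ hI β
  obtain ⟨M, hM⟩ := (hI.prod hΩ.isCompact).exists_bound_of_continuousOn hluc
  have key := hΩ.tendsto_integral_slope_mul hIc
    (m := fun s x => lap S (fun x => v s x ^ β) x + lap S (fun x => v t x ^ β) x) (M := M + M) ht
    (fun s hs x hx => hv.hasDerivWithinAt_rpow hΩ β hs hx) hC
    (fun s hs x hx => (norm_add_le _ _).trans (add_le_add (hM (s, x) ⟨hs, subset_closure hx⟩)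
      (hM (t, x) ⟨ht, subset_closure hx⟩)))
    (fun s hs => (hu s hs).continuousOn.mono subset_closure)
    (fun s hs => ((hlx s hs).add (hlx t ht)).mono subset_closure)
    fun x hx => (hlt x (subset_closure hx) t ht).add continuousWithinAt_const
  rw [hasDerivWithinAt_iff_tendsto_slope]
  have hlim : -(∫ x in Ω, β * v t x ^ (β - 1) * flowSpeed S p β (v t) x *
      (lap S (fun x => v t x ^ β) x + lap S (fun x => v t x ^ β) x)) =
      -(2 * β ^ 2) * ∫ x in Ω, (lap S (v t) x + (β - 1) * (gradSq S (v t) x / v t x)) *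
        (lap S (v t) x + kappa p β * (gradSq S (v t) x / v t x)) := by
    rw [neg_mul, ← integral_const_mul]
    congr 1
    refine setIntegral_congr_fun hΩ.isOpen.measurableSet fun x hx => ?_
    have hxS : x ∈ S := subset_closure hx
    have hone : v t x ^ (β + 1 - 2 * β) * v t x ^ (β - 1) = 1 := by
      rw [← Real.rpow_add (hv.pos t ht x hxS)]
      ring_nf
      exact Real.rpow_zero _
    rw [mul_assoc β, hv.rpow_mul_flowSpeed ht _ hxS, hlu t ht x hxS]
    linear_combination 2 * β ^ 2 * (lap S (v t) x + (β - 1) * (gradSq S (v t) x / v t x)) *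
      (lap S (v t) x + kappa p β * (gradSq S (v t) x / v t x)) * hone
  rw [← hlim]
  refine key.neg.congr' ?_
  filter_upwards [self_mem_nhdsWithin] with s hs
  have hN : ∀ r ∈ I, NeumannCondition Ω fun x => v r x ^ β := fun r hr =>
    (hv.neumann r hr).rpow hΩ ((hv.contDiffOn r hr).differentiableOn (by simp)) (hv.pos r hr) β
  have hdiff := (hN s hs.1).integral_gradSq_sub hΩ (hN t ht) (hu s hs.1) (hu t ht)
  rw [slope, vsub_eq_sub, smul_eq_mul, hdiff, mul_neg, ← integral_const_mul]
  congr 1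
  refine integral_congr_ae (ae_of_all _ fun x => ?_)
  beta_reduce
  ring

end IsFlowSolution

theorem IsSmoothConvexDomain.normL_rpow (hΩ : IsSmoothConvexDomain Ω) {f : E d → ℝ}
    (hpos : ∀ x ∈ closure Ω, 0 < f x) (q β : ℝ) :
    normL Ω q (fun x => f x ^ β) = (∫ x in Ω, f x ^ (β * q)) ^ (1 / q) := by
  rw [normL]
  congr 1
  refine setIntegral_congr_fun hΩ.isOpen.measurableSet fun x hx => ?_
  have h0 := hpos x (subset_closure hx)
  rw [abs_of_pos (Real.rpow_pos_of_pos h0 _), ← Real.rpow_mul h0.le]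

/-- The derivative of the functional along the flow, on a compact time interval. -/
theorem IsFlowSolution.hasDerivWithinAt_functionalJ (hΩ : IsSmoothConvexDomain Ω)
    (hv : IsFlowSolution Ω p β I v) (hp1 : p ≠ 1) (Λ : ℝ) (hI : IsCompact I)
    (hIc : Convex ℝ I) {t : ℝ} (ht : t ∈ I) :
    HasDerivWithinAt (fun s => functionalJ Ω p Λ fun x => v s x ^ β)
      (-(2 * β ^ 2) * ((∫ x in Ω,
        (lap (closure Ω) (v t) x + (β - 1) * (gradSq (closure Ω) (v t) x / v t x)) *
        (lap (closure Ω) (v t) x + kappa p β * (gradSq (closure Ω) (v t) x / v t x))) -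
        Λ * ∫ x in Ω, gradSq (closure Ω) (v t) x)) I t := by
  have hA := hv.hasDerivWithinAt_integral_gradSq hΩ hI hIc ht
  have hM := hv.hasDerivWithinAt_integral_sq hΩ hI hIc ht
  have hN := hv.hasDerivWithinAt_integral_rpow_succ hΩ hI hIc ht
  -- Positivity is needed to differentiate the power 1/(p+1) of this integral.
  have hNpos : 0 < ∫ x in Ω, v t x ^ (β * (p + 1)) := by
    have hc := (contDiffOn_rpow (hv.contDiffOn t ht) (hv.pos t ht) (β * (p + 1))).continuousOn
    rw [setIntegral_pos_iff_support_of_nonneg_ae]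
    · have hsub : Ω ⊆ (Function.support fun x => v t x ^ (β * (p + 1))) ∩ Ω := fun x hx =>
        ⟨(Real.rpow_pos_of_pos (hv.pos t ht x (subset_closure hx)) _).ne', hx⟩
      exact (hΩ.isOpen.measure_pos volume hΩ.nonempty).trans_le (measure_mono hsub)
    · filter_upwards [ae_restrict_mem hΩ.isOpen.measurableSet] with x hx
      exact (Real.rpow_pos_of_pos (hv.pos t ht x (subset_closure hx)) _).le
    · exact hΩ.integrableOn hc
  have hN' := (hN.rpow_const (p := 1 / (p + 1)) (Or.inl hNpos.ne')).pow 2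
  have hJ : ∀ s ∈ I, functionalJ Ω p Λ (fun x => v s x ^ β) =
      (∫ x in Ω, gradSq (closure Ω) (fun x => v s x ^ β) x) - Λ / (p - 1) *
        (((∫ x in Ω, v s x ^ (β * (p + 1))) ^ (1 / (p + 1))) ^ 2 -
          ∫ x in Ω, v s x ^ (β * 2)) := fun s hs => by
    have h2 : normL Ω 2 (fun x => v s x ^ β) ^ 2 = ∫ x in Ω, v s x ^ (β * 2) := by
      rw [hΩ.normL_rpow (hv.pos s hs), ← Real.sqrt_eq_rpow, Real.sq_sqrt]
      exact setIntegral_nonneg hΩ.isOpen.measurableSet fun x hx =>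
        (Real.rpow_pos_of_pos (hv.pos s hs x (subset_closure hx)) _).le
    rw [functionalJ, h2, hΩ.normL_rpow (hv.pos s hs)]
    congr 1
    exact setIntegral_congr_fun hΩ.isOpen.measurableSet fun x hx =>
      norm_gradient_sq (hΩ.closure_mem_nhds hx) _
  have hD := hA.sub ((hN'.sub hM).const_mul (Λ / (p - 1)))
  refine (hD.congr (fun s hs => hJ s hs) (hJ t ht)).congr_deriv ?_
  have : p - 1 ≠ 0 := sub_ne_zero.2 hp1
  simp only [zero_mul, mul_zero, zero_sub]
  rw [mul_neg, sub_neg_eq_add, mul_assoc (2 * β ^ 2), mul_left_comm (2 * β ^ 2) (p - 1),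
    ← mul_assoc (Λ / (p - 1)), div_mul_cancel₀ _ this]
  generalize ∫ x in Ω, gradSq (closure Ω) (v t) x = B
  rw [mul_sub, sub_eq_add_neg]
  congr 1
  ring

/-- A point of an interval has a neighbourhood, within the interval, that is a compact interval. -/
theorem exists_compact_interval_mem_nhdsWithin {I : Set ℝ} (hI : I.OrdConnected) {t : ℝ}
    (ht : t ∈ I) : ∃ a b, Icc a b ⊆ I ∧ t ∈ Icc a b ∧ Icc a b ∈ 𝓝[I] t := by
  have hl : ∃ a ∈ I, a ≤ t ∧ Ici a ∈ 𝓝[I] t := by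
    by_cases h : ∃ a ∈ I, a < t
    · obtain ⟨a, ha, hat⟩ := h
      exact ⟨a, ha, hat.le, mem_nhdsWithin_of_mem_nhds (Ici_mem_nhds hat)⟩
    · push Not at h
      exact ⟨t, ht, le_rfl, mem_of_superset self_mem_nhdsWithin h⟩
  have hr : ∃ b ∈ I, t ≤ b ∧ Iic b ∈ 𝓝[I] t := by
    by_cases h : ∃ b ∈ I, t < b
    · obtain ⟨b, hb, htb⟩ := h
      exact ⟨b, hb, htb.le, mem_nhdsWithin_of_mem_nhds (Iic_mem_nhds htb)⟩
    · push Not at h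
      exact ⟨t, ht, le_rfl, mem_of_superset self_mem_nhdsWithin h⟩
  obtain ⟨a, ha, hat, han⟩ := hl
  obtain ⟨b, hb, htb, hbn⟩ := hr
  exact ⟨a, b, hI.out ha hb, ⟨hat, htb⟩, inter_mem han hbn⟩

/-! ### The roots of R. -/

section Parameters

variable {θ : ℝ}

theorem thetaStar_nonneg (hp0 : 0 < p) : 0 ≤ thetaStar p d := by
  rw [thetaStar]
  positivity

theorem constR_eq (θ p : ℝ) (d : ℕ) (β : ℝ) :
    constR θ p d β = -(coefA θ p d * β ^ 2 - 2 * coefB p d * β + 1) := by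
  have hd : (d : ℝ) + 2 ≠ 0 := by positivity
  rw [constR, coefA, coefB, kappa]
  field_simp
  ring

/-- b² - a equals p/((d+2)²θ) times θ(d(d+2)+p) - (d-1)²p, and the last factor is positive exactly
when θ > θ⋆. -/
theorem coefA_lt_sq_coefB (hp0 : 0 < p) (hθ : thetaStar p d < θ) :
    coefA θ p d < coefB p d ^ 2 := by
  have hθ0 : 0 < θ := (thetaStar_nonneg hp0).trans_lt hθ
  have hd : (0 : ℝ) < d + 2 := by positivity
  have hden : 0 < (d : ℝ) * (d + 2) + p := by positivity
  rw [thetaStar, div_lt_iff₀ hden] at hθ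
  have e : coefB p d ^ 2 - coefA θ p d =
      p / ((d + 2) ^ 2 * θ) * (θ * (d * (d + 2) + p) - (d - 1) ^ 2 * p) := by
    rw [coefA, coefB]
    field_simp
    ring
  have : 0 < coefB p d ^ 2 - coefA θ p d := by
    rw [e]
    exact mul_pos (by positivity) (by linarith)
  linarith

theorem constR_eq_mul (hp0 : 0 < p) (hθ : thetaStar p d < θ) (ha : coefA θ p d ≠ 0) (β : ℝ) :
    constR θ p d β = -(coefA θ p d * ((β - betaMinus θ p d) * (β - betaPlus θ p d))) := by
  have hs : √(coefB p d ^ 2 - coefA θ p d) ^ 2 = coefB p d ^ 2 - coefA θ p d :=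
    Real.sq_sqrt (sub_nonneg.2 (coefA_lt_sq_coefB hp0 hθ).le)
  rw [constR_eq, betaMinus, betaPlus]
  generalize √(coefB p d ^ 2 - coefA θ p d) = r at hs
  field_simp
  linear_combination -hs

theorem betaPlus_sub_betaMinus (θ p : ℝ) (d : ℕ) :
    betaPlus θ p d - betaMinus θ p d = 2 * √(coefB p d ^ 2 - coefA θ p d) / coefA θ p d := by
  rw [betaMinus, betaPlus]
  ring

end Parameters

end NeumannFlow

theorem mainTheorem7 {d : ℕ} (hd : 1 ≤ d) (Ω : Set (NeumannFlow.E d))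
    (hΩ_open : IsOpen Ω) (hΩ_bdd : Bornology.IsBounded Ω) (hΩ_conv : Convex ℝ Ω)
    (hΩ_smooth : NeumannFlow.HasSmoothBoundary Ω) (hΩ_vol : volume Ω = 1)
    (p : ℝ) (hp0 : 0 < p) (hp1 : p ≠ 1)
    (θ : ℝ) (hθ : θ ∈ Ioo (NeumannFlow.thetaStar p d) 1) :
    -- `R = 0` has the two roots `β₋`, `β₊`
    (NeumannFlow.coefA θ p d ≠ 0 →
      NeumannFlow.betaMinus θ p d ≠ NeumannFlow.betaPlus θ p d ∧
      ∀ β : ℝ, NeumannFlow.constR θ p d β = 0 ↔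
        β = NeumannFlow.betaMinus θ p d ∨ β = NeumannFlow.betaPlus θ p d) ∧
    -- `R > 0` exactly on `(β₋, β₊)`
    (0 < NeumannFlow.coefA θ p d →
      NeumannFlow.betaMinus θ p d < NeumannFlow.betaPlus θ p d ∧
      ∀ β : ℝ, 0 < NeumannFlow.constR θ p d β ↔
        β ∈ Ioo (NeumannFlow.betaMinus θ p d) (NeumannFlow.betaPlus θ p d)) ∧
    -- the decay of the functional along the flow
    (∀ β : ℝ, 0 < NeumannFlow.constR θ p d β →
      ∀ Λ : ℝ, Λ ≤ (1 - θ) * NeumannFlow.lambda2 Ω →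
      ∀ I : Set ℝ, I.OrdConnected → I.Nontrivial →
      ∀ v : ℝ → NeumannFlow.E d → ℝ, NeumannFlow.IsFlowSolution Ω p β I v →
      ∀ t ∈ I,
        IntegrableOn (fun x => ‖∇ (v t) x‖ ^ 4 / v t x ^ 2) Ω ∧
        ∃ D : ℝ,
          HasDerivWithinAt (fun s => NeumannFlow.functionalJ Ω p Λ (fun x => v s x ^ β)) D I t ∧
          D ≤ -(NeumannFlow.constR θ p d β) * β ^ 2 *
            ∫ x in Ω, ‖∇ (v t) x‖ ^ 4 / v t x ^ 2) := by
  open NeumannFlow in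
  have hθ0 : 0 < θ := (thetaStar_nonneg hp0).trans_lt hθ.1
  have hsqrt : 0 < √(coefB p d ^ 2 - coefA θ p d) :=
    Real.sqrt_pos.2 (sub_pos.2 (coefA_lt_sq_coefB hp0 hθ.1))
  refine ⟨fun ha => ⟨fun h => ?_, fun β => ?_⟩, fun ha => ?_, ?_⟩
  · have h1 := betaPlus_sub_betaMinus θ p d
    rw [h, sub_self] at h1
    exact (div_ne_zero (mul_pos two_pos hsqrt).ne' ha) h1.symm
  · rw [constR_eq_mul hp0 hθ.1 ha, neg_eq_zero, mul_eq_zero, mul_eq_zero, sub_eq_zero, sub_eq_zero]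
    simp [ha]
  · have hlt : betaMinus θ p d < betaPlus θ p d := by
      rw [← sub_pos, betaPlus_sub_betaMinus]
      positivity
    refine ⟨hlt, fun β => ?_⟩
    rw [constR_eq_mul hp0 hθ.1 ha.ne', neg_pos]
    constructor
    · intro h
      rcases mul_neg_iff.1 (neg_of_mul_neg_right h ha.le) with ⟨h1, h2⟩ | ⟨h1, h2⟩
      · exact ⟨by linarith, by linarith⟩
      · exfalso
        linarith
    · rintro ⟨h1, h2⟩
      exact mul_neg_of_pos_of_neg ha (mul_neg_of_pos_of_neg (by linarith) (by linarith))
  · intro β hR Λ hΛ I hI _ v hv t ht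
    have hΩ : IsSmoothConvexDomain Ω :=
      ⟨hΩ_open, hΩ_bdd, hΩ_conv, nonempty_of_measure_ne_zero (by rw [hΩ_vol]; exact one_ne_zero),
        hΩ_smooth⟩
    have hv3 := hv.contDiffOn t ht
    have hpos := hv.pos t ht
    have hpt : EqOn (fun x => ‖∇ (v t) x‖ ^ 4 / v t x ^ 2)
        (fun x => gradSq (closure Ω) (v t) x ^ 2 / v t x ^ 2) Ω := fun x hx => by
      beta_reduce
      rw [← norm_gradient_sq (hΩ.closure_mem_nhds hx), ← pow_mul]
    refine ⟨?_, ?_⟩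
    · rw [integrableOn_congr_fun hpt hΩ_open.measurableSet]
      have hTc := (contDiffOn_gradSq (m := 1) hΩ.uniqueDiffOn hv3 (by norm_num)).continuousOn
      exact hΩ.integrableOn ((hTc.pow 2).div (hv3.continuousOn.pow 2) fun x hx =>
        pow_ne_zero 2 (hpos x hx).ne')
    -- The time interval may be open or unbounded, while the uniform bounds need compactness.
    -- Differentiability within `I` at `t` is local, so a compact subinterval is enough, also at an
    -- end point.
    · obtain ⟨a, b, hab, htab, hnhds⟩ := exists_compact_interval_mem_nhdsWithin hI ht
      refine ⟨_, ((hv.mono hab).hasDerivWithinAt_functionalJ hΩ hp1 Λ isCompact_Icc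
        (convex_Icc a b) htab).mono_of_mem_nhdsWithin hnhds, ?_⟩
      rw [setIntegral_congr_fun hΩ_open.measurableSet hpt]
      have hest := (hv.neumann t ht).constR_mul_integral_le hd hΩ hΩ_vol hv3 hpos hθ0 hθ.2 p β hΛ
      -- The estimate yields the decay rate 2Rβ²; since R > 0, half of it may be dropped.
      have hX : 0 ≤ constR θ p d β * ∫ x in Ω, gradSq (closure Ω) (v t) x ^ 2 / v t x ^ 2 :=
        mul_nonneg hR.le (integral_nonneg fun x => by positivity)
      nlinarith [mul_le_mul_of_nonneg_left hest (sq_nonneg β), mul_nonneg (sq_nonneg β) hX]
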